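/- For $x=(x_1,x_2,x_3)\in\mathbb R^3$ put $r=(x_1^2+x_2^2)^{1/2}$, $\partial_r=\frac{x_1}{r}\partial_1+\frac{x_2}{r}\partial_2$, and call a scalar function $u:\mathbb R^3\to\mathbb R$ axisymmetric if it depends only on $(r,x_3)$. For a function $u$ with $\int_{\mathbb R^3}\frac{|u(y)|}{(1+|y|)^3}\,dy<\infty$ let $\Delta^{-1}u$ be the Newtonian potential $$\Delta^{-1}u(x)=-\frac1{4\pi}\int_{\mathbb R^3}\frac{u(y)}{|x-y|}\,dy\qquad\text{if }\int_{\mathbb R^3}\frac{|u(y)|}{1+|y|}\,dy<\infty,$$ and otherwise its normalization by affine functions $$\Delta^{-1}u(x)=-\frac1{4\pi}\int_{\mathbb R^3}\Big(\frac1{|x-y|}-\mathbf 1_{\{|y|>1\}}\Big(\frac1{|y|}+\frac{x\cdot y}{|y|^3}\Big)\Big)u(y)\,dy .$$ Let $\mathcal R_{ij}=\partial_i\partial_j\Delta^{-1}$ be the Riesz transforms. For $1<p<\infty$ and $1\le q\le\infty$ let $$\|f\|_{L^{p,q}}=\Big(p\int_0^\infty\big(t\,|\{|f|>t\}|^{1/p}\big)^q\frac{dt}{t}\Big)^{1/q}\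 (q<\infty),\qquad \|f\|_{L^{p,\infty}}=\sup_{t>0}t\,|\{|f|>t\}|^{1/p}.$$ **Proposition 2.9.** (i) Let $u\in C^\infty(\mathbb R^3)$ be axisymmetric with $\int|u(y)|(1+|y|)^{-3}\,dy<\infty$. Then $\Delta^{-1}u\in C^\infty(\mathbb R^3)$, $\Delta\Delta^{-1}u=\sum_i\mathcal R_{ii}u=u$, and at every point with $r\neq0$ $$\frac{\partial_r}{r}\Delta^{-1}u=\frac{x_2^2}{r^2}\mathcal R_{11}u+\frac{x_1^2}{r^2}\mathcal R_{22}u-2\frac{x_1x_2}{r^2}\mathcal R_{12}u .$$ (ii) For all $1<p<\infty$ and $1\le q\le\infty$ there is a constant $C>0$ such that every axisymmetric $u\in C^\infty(\mathbb R^3)$ with $\|u\|_{L^{p,q}}<\infty$ satisfies $\int|u(y)|(1+|y|)^{-3}\,dy<\infty$ and $$\Big\|\frac{\partial_r}{r}\Delta^{-1}u\Big\|_{L^{p,q}}\le C\,\|u\|_{L^{p,q}} .$$ -/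

import Mathlib

open MeasureTheory

noncomputable section

namespace Axisym

/-- Three-dimensional Euclidean space; the coordinates `x_1, x_2, x_3` are `x 0, x 1, x 2`. -/
abbrev E3 := EuclideanSpace ℝ (Fin 3)

/-- The distance to the vertical axis, `r = (x_1² + x_2²)^{1/2}`. -/
def r (x : E3) : ℝ := Real.sqrt (x 0 ^ 2 + x 1 ^ 2)

/-- A scalar function is axisymmetric if it depends on `(r, x_3)` only. -/
def IsAxisymmetric (u : E3 → ℝ) : Prop :=
  ∀ x y : E3, r x = r y → x 2 = y 2 → u x = u y

/-- The partial derivative `∂_{i+1} f` (the coordinates are numbered from `0` here). -/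
def pd (i : Fin 3) (f : E3 → ℝ) (x : E3) : ℝ :=
  fderiv ℝ f x (EuclideanSpace.single i 1)

/-- The operator `∂_r / r`, where `∂_r = (x_1 / r) ∂_1 + (x_2 / r) ∂_2`.
It is meaningful off the axis `r = 0`, which is a null set. -/
def drOverR (f : E3 → ℝ) (x : E3) : ℝ :=
  (x 0 / r x * pd 0 f x + x 1 / r x * pd 1 f x) / r x

/-- The Newtonian potential `- (1 / 4π) ∫ u(y) / |x - y| dy`. -/
def newtonPotential (u : E3 → ℝ) (x : E3) : ℝ :=
  -(1 / (4 * Real.pi)) * ∫ y, u y / ‖x - y‖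

/-- The Newtonian potential in which, for `|y| > 1`, the first-order Taylor polynomial
`1 / |y| + x ⬝ y / |y|³` of `x ↦ 1 / |x - y|` at the origin has been subtracted from the kernel.
The new kernel is `O(|y|⁻³)` at infinity, and the subtraction changes the potential formally by an
affine function of `x` only. -/
def normalizedNewtonPotential (u : E3 → ℝ) (x : E3) : ℝ :=
  -(1 / (4 * Real.pi)) * ∫ y, u y *
    (1 / ‖x - y‖ - if 1 < ‖y‖ then 1 / ‖y‖ + inner ℝ x y / ‖y‖ ^ 3 else 0)

/-- The domain on which the inverse Laplacian is considered: `∫ |u(y)| / (1 + |y|)³ dy < ∞`. -/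
def HasInvLaplacian (u : E3 → ℝ) : Prop :=
  Integrable (fun y : E3 => u y / (1 + ‖y‖) ^ 3)

open Classical in
/-- The inverse Laplacian `Δ⁻¹ u`: the Newtonian potential of `u` if that integral converges
absolutely, and otherwise its normalization by affine functions, the usual meaning of `Δ⁻¹ u` for
functions with little decay. -/
def invLaplacian (u : E3 → ℝ) : E3 → ℝ :=
  if Integrable (fun y : E3 => u y / (1 + ‖y‖)) then newtonPotential u
  else normalizedNewtonPotential u

/-- The (double) Riesz transforms `R_{ij} = ∂_i ∂_j Δ⁻¹`. -/
def riesz (i j : Fin 3) (u : E3 → ℝ) : E3 → ℝ :=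
  pd i (pd j (invLaplacian u))

/-- The distribution function `t ↦ |{x : |f(x)| > t}|`. -/
def distrib (f : E3 → ℝ) (t : ℝ) : ENNReal :=
  volume {x : E3 | t < |f x|}

open Classical in
/-- The Lorentz (quasi-)norm of `L^{p,q}(ℝ³)`, for `0 < p < ∞`, `0 < q ≤ ∞`: with `d` the
distribution function of `f`, it is `(p ∫_0^∞ (t d(t)^{1/p})^q dt / t)^{1/q}` for `q < ∞`, and
`sup_{t > 0} t d(t)^{1/p}` for `q = ∞`. -/
def lorentzNorm (p : ℝ) (q : ENNReal) (f : E3 → ℝ) : ENNReal :=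
  if q = ⊤ then
    ⨆ (t : ℝ) (_ : 0 < t), ENNReal.ofReal t * distrib f t ^ (1 / p)
  else
    (ENNReal.ofReal p * ∫⁻ t in Set.Ioi (0 : ℝ),
      (ENNReal.ofReal t * distrib f t ^ (1 / p)) ^ q.toReal / ENNReal.ofReal t) ^ (1 / q.toReal)

end Axisym

end

noncomputable section

namespace Axisym

open Filter Topology

/-! Write `v` for `Δ⁻¹ u`. For part (i), cut `u` with a bump equal to 1 on a large ball of radius
`R`. For `‖x‖ < R / 2`, up to the factor `-1 / (4π)`, `v` is the Coulomb potential of a smooth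
compactly supported density, plus the potential of a density living far away taken against the
Taylor-subtracted kernel, plus an affine function (`exists_local_representation`). This covers both
branches of `invLaplacian`, which near `x` differ only in the affine term. The first piece is a
convolution whose Laplacian is computed by regularizing `1 / |z|`. In the second, the subtracted
kernel and its derivatives in `x` are `O(|y|⁻³)`, so one may differentiate under the integral, and
the result is harmonic near `x`. This gives `contDiff_invLaplacian` and `sum_riesz`. Both kernels
are invariant under linear isometries, so `v` is axisymmetric; differentiating the identity "angular
derivative of `v` is zero" yields the formula with second derivatives (`IsAxisymmetric.radial`).

For part (ii) no singular integral theory is needed, because symmetry turns the operator into a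
positive one. Off the plane `x₁ = 0` one has `∂_r v / r = ∂₁ v / x₁`, and `∂₁ v` is odd under the
reflection `x ↦ x*` in that plane, so `2 ∂₁ v(x) = ∂₁ v(x) - ∂₁ v(x*)`. This difference forgets the
normalization and is an absolutely convergent integral of `u` against a difference of Coulomb fields
at points `2|x₁|` apart. Dividing by `x₁` leaves a kernel dominated by `|x - y|⁻² max(|x - y|, |x₁|,
|y₁|)⁻¹` and its reflected copy (`enorm_drOverR_invLaplacian_le`). The dominating kernel has degree
-3, yet its singularity on the diagonal is only `|x - y|⁻²` off the plane, and it maps the weights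
`|x₁|^{-a}`, `0 < a < 1`, to multiples of themselves. The Schur test then gives `L^p` bounds for
every `1 < p < ∞` (`lintegral_domOp_rpow_le`).

Interpolating between the exponents `p ± ε` in dyadic form gives the Lorentz bound
(`exists_lorentzNorm_le`). That `Δ⁻¹ u` is defined at all follows from `L^{p,q} ⊂ L^{p,∞} ⊂ L¹ +
L^{p+1}` and Hölder (`hasInvLaplacian_of_lorentzNorm`). -/

/-! ### Calculus of the regularized Coulomb kernel. -/

/-- The regularized Coulomb kernel `(|z|² + c)^{-1/2}`. -/
def regKernel (c : ℝ) (z : E3) : ℝ := (Real.sqrt (‖z‖ ^ 2 + c))⁻¹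

lemma regKernel_zero (z : E3) : regKernel 0 z = ‖z‖⁻¹ := by
  simp [regKernel]

lemma regKernel_nonneg (c : ℝ) (z : E3) : 0 ≤ regKernel c z := by
  unfold regKernel; positivity

lemma norm_sq_eq_sum (z : E3) : ‖z‖ ^ 2 = ∑ i, z i ^ 2 := by
  rw [EuclideanSpace.norm_sq_eq]; simp

lemma inner_single_right (z : E3) (i : Fin 3) :
    inner ℝ z (EuclideanSpace.single i 1) = z i := by
  rw [EuclideanSpace.inner_single_right]; simp

lemma abs_apply_le_norm (z : E3) (i : Fin 3) : |z i| ≤ ‖z‖ := by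
  simpa using PiLp.norm_apply_le z i

lemma hasFDerivAt_regKernel {c : ℝ} {z : E3} (h : 0 < ‖z‖ ^ 2 + c) :
    HasFDerivAt (regKernel c) ((-(regKernel c z) ^ 3) • innerSL ℝ z) z := by
  have h1 : HasFDerivAt (fun z : E3 => ‖z‖ ^ 2 + c) ((2 : ℝ) • innerSL ℝ z) z := by
    simpa [two_smul] using (hasStrictFDerivAt_norm_sq z).hasFDerivAt.add_const c
  have hs : 0 < Real.sqrt (‖z‖ ^ 2 + c) := Real.sqrt_pos.2 h
  have h2 : HasDerivAt (fun s : ℝ => (Real.sqrt s)⁻¹)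
      (-(1 / (2 * Real.sqrt (‖z‖ ^ 2 + c))) / Real.sqrt (‖z‖ ^ 2 + c) ^ 2) (‖z‖ ^ 2 + c) :=
    (Real.hasDerivAt_sqrt h.ne').fun_inv hs.ne'
  refine (h2.comp_hasFDerivAt z h1).congr_fderiv ?_
  rw [smul_smul]
  congr 1
  unfold regKernel
  field_simp

lemma contDiffAt_regKernel {c : ℝ} {z : E3} (h : 0 < ‖z‖ ^ 2 + c) {n : WithTop ℕ∞} :
    ContDiffAt ℝ n (regKernel c) z := by
  unfold regKernel
  have h1 : ContDiffAt ℝ n (fun z : E3 => ‖z‖ ^ 2 + c) z := by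
    have := contDiff_norm_sq ℝ (E := E3) (n := n)
    exact this.contDiffAt.add contDiffAt_const
  exact (h1.sqrt h.ne').inv (Real.sqrt_pos.2 h).ne'

lemma pd_regKernel {c : ℝ} {z : E3} (h : 0 < ‖z‖ ^ 2 + c) (i : Fin 3) :
    pd i (regKernel c) z = -(regKernel c z) ^ 3 * z i := by
  unfold pd
  rw [(hasFDerivAt_regKernel h).fderiv]
  simp [inner_single_right]

lemma pd_pd_regKernel {c : ℝ} {z : E3} (h : 0 < ‖z‖ ^ 2 + c) (i : Fin 3) :
    pd i (pd i (regKernel c)) z = 3 * (regKernel c z) ^ 5 * z i ^ 2 - (regKernel c z) ^ 3 := by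
  have ho : ∀ᶠ y : E3 in 𝓝 z, 0 < ‖y‖ ^ 2 + c :=
    ((continuous_norm.pow 2).add continuous_const).continuousAt.eventually_const_lt h
  have he : pd i (regKernel c) =ᶠ[𝓝 z] fun y => -(regKernel c y) ^ 3 * y i :=
    ho.mono fun y hy => pd_regKernel hy i
  have h1 := hasFDerivAt_regKernel h
  have h2 : HasFDerivAt (fun y : E3 => y i) (EuclideanSpace.proj i : E3 →L[ℝ] ℝ) z :=
    (EuclideanSpace.proj i : E3 →L[ℝ] ℝ).hasFDerivAt
  have h3 : HasFDerivAt (fun y : E3 => -(regKernel c y) ^ 3 * y i) _ z := ((h1.pow 3).neg).mul h2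
  have : pd i (pd i (regKernel c)) z
      = fderiv ℝ (fun y : E3 => -(regKernel c y) ^ 3 * y i) z (EuclideanSpace.single i 1) := by
    unfold pd at he ⊢
    rw [he.fderiv_eq]
  rw [this, h3.fderiv]
  simp [inner_single_right]
  ring

lemma regKernel_sq_mul {c : ℝ} {z : E3} (h : 0 < ‖z‖ ^ 2 + c) :
    (regKernel c z) ^ 2 * (‖z‖ ^ 2 + c) = 1 := by
  unfold regKernel
  rw [inv_pow, Real.sq_sqrt h.le, inv_mul_cancel₀ h.ne']

/-- For `c = ε²` the right-hand side is minus an approximate identity of mass `4π`; for `c = 0` it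
is the harmonicity of `1 / |z|` off the origin. -/
lemma sum_pd_pd_regKernel {c : ℝ} {z : E3} (h : 0 < ‖z‖ ^ 2 + c) :
    ∑ i, pd i (pd i (regKernel c)) z = -(3 * c * (regKernel c z) ^ 5) := by
  simp only [pd_pd_regKernel h, Finset.sum_sub_distrib, ← Finset.mul_sum, ← norm_sq_eq_sum]
  have := regKernel_sq_mul h
  simp
  linear_combination (3 * regKernel c z ^ 3) * this

lemma regKernel_le {c : ℝ} (hc : 0 ≤ c) {z : E3} (hz : z ≠ 0) : regKernel c z ≤ ‖z‖⁻¹ := by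
  unfold regKernel
  have := norm_pos_iff.2 hz
  gcongr
  exact Real.le_sqrt_of_sq_le (by linarith)

lemma tendsto_regKernel {z : E3} (hz : z ≠ 0) :
    Tendsto (fun ε : ℝ => regKernel (ε ^ 2) z) (𝓝[>] 0) (𝓝 ‖z‖⁻¹) := by
  have h : ContinuousAt (fun ε : ℝ => regKernel (ε ^ 2) z) 0 := by
    unfold regKernel
    have h1 : Real.sqrt (‖z‖ ^ 2 + 0 ^ 2) ≠ 0 := by simpa using hz
    exact ContinuousAt.inv₀ (by fun_prop) h1
  have h2 := h.tendsto
  simp only [ne_eq, OfNat.ofNat_ne_zero, not_false_eq_true, zero_pow, regKernel_zero] at h2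
  exact h2.mono_left nhdsWithin_le_nhds

lemma continuous_regKernel {c : ℝ} (hc : 0 < c) : Continuous (regKernel c) :=
  continuous_iff_continuousAt.2 fun _ => (contDiffAt_regKernel (n := 0) (by positivity)).continuousAt

/-! ### The fundamental solution of the Laplacian. -/

lemma locallyIntegrable_norm_inv_pow {k : ℕ} (hk : k < 3) :
    LocallyIntegrable (fun z : E3 => (‖z‖⁻¹) ^ k) := by
  refine locallyIntegrable_of_norm_le_rpow (C := 1) (α := k) (by simp) ?_ ?_ ?_
  · simpa using hk
  · refine Eventually.of_forall fun z => le_of_eq ?_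
    rw [Real.rpow_neg (norm_nonneg _), Real.rpow_natCast]
    simp
  · fun_prop

lemma integrable_norm_inv_pow_mul {k : ℕ} (hk : k < 3) {f : E3 → ℝ} (hf : Continuous f)
    (hs : HasCompactSupport f) : Integrable (fun z : E3 => (‖z‖⁻¹) ^ k * f z) :=
  (locallyIntegrable_norm_inv_pow hk).integrable_smul_right_of_hasCompactSupport hf hs

lemma ae_ne_zero : ∀ᵐ z : E3, z ≠ 0 := by
  simp [ae_iff]

lemma continuous_pd {f : E3 → ℝ} (hf : ContDiff ℝ 1 f) (i : Fin 3) : Continuous (pd i f) :=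
  (hf.continuous_fderiv one_ne_zero).clm_apply continuous_const

lemma contDiff_pd {f : E3 → ℝ} (hf : ContDiff ℝ (⊤ : ℕ∞) f) (i : Fin 3) :
    ContDiff ℝ (⊤ : ℕ∞) (pd i f) :=
  (hf.fderiv_right (m := (⊤ : ℕ∞)) (by simp)).clm_apply contDiff_const

lemma hasCompactSupport_pd {f : E3 → ℝ} (hf : HasCompactSupport f) (i : Fin 3) :
    HasCompactSupport (pd i f) := hf.fderiv_apply ℝ _

lemma integral_regKernel_mul_pd {c : ℝ} (hc : 0 < c) {f : E3 → ℝ} (hf : ContDiff ℝ 1 f)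
    (hs : HasCompactSupport f) (i : Fin 3) :
    ∫ z, regKernel c z * pd i f z = - ∫ z, pd i (regKernel c) z * f z := by
  have hN : ContDiff ℝ 1 (regKernel c) :=
    contDiff_iff_contDiffAt.2 fun z => contDiffAt_regKernel (by positivity)
  refine integral_mul_fderiv_eq_neg_fderiv_mul_of_integrable ?_ ?_ ?_
    (fun x _ => hN.differentiable one_ne_zero x) (fun x _ => hf.differentiable one_ne_zero x)
  · exact ((continuous_pd hN i).mul hf.continuous).integrable_of_hasCompactSupport hs.mul_left
  · exact (hN.continuous.mul (continuous_pd hf i)).integrable_of_hasCompactSupport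
      (hasCompactSupport_pd hs i).mul_left
  · exact (hN.continuous.mul hf.continuous).integrable_of_hasCompactSupport hs.mul_left

lemma self_mem_pos : ∀ᶠ ε : ℝ in 𝓝[>] 0, 0 < ε := eventually_mem_nhdsWithin

lemma tendsto_integral_regKernel_mul {f : E3 → ℝ} (hf : Continuous f)
    (hs : HasCompactSupport f) :
    Tendsto (fun ε : ℝ => ∫ z, regKernel (ε ^ 2) z * f z) (𝓝[>] 0) (𝓝 (∫ z, ‖z‖⁻¹ * f z)) := by
  refine tendsto_integral_filter_of_dominated_convergence (fun z => ‖‖z‖⁻¹ ^ 1 * f z‖) ?_ ?_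
    (integrable_norm_inv_pow_mul (by norm_num) hf hs).norm ?_
  · filter_upwards [self_mem_pos] with ε hε
    exact ((continuous_regKernel (by positivity)).mul hf).aestronglyMeasurable
  · filter_upwards [self_mem_pos] with ε hε
    filter_upwards [ae_ne_zero] with z hz
    rw [norm_mul, norm_mul, pow_one, norm_inv, norm_norm,
      Real.norm_of_nonneg (regKernel_nonneg _ _)]
    gcongr
    exact regKernel_le (by positivity) hz
  · filter_upwards [ae_ne_zero] with z hz
    exact (tendsto_regKernel hz).mul_const _

/-- Dominated convergence: uniformly in `ε` the gradient of the kernel is at most `|z|⁻²`, which is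
locally integrable in dimension three. -/
lemma tendsto_integral_pd_regKernel_mul {f : E3 → ℝ} (hf : Continuous f)
    (hs : HasCompactSupport f) (i : Fin 3) :
    Tendsto (fun ε : ℝ => ∫ z, pd i (regKernel (ε ^ 2)) z * f z) (𝓝[>] 0)
      (𝓝 (∫ z, -(‖z‖⁻¹) ^ 3 * z i * f z)) := by
  refine tendsto_integral_filter_of_dominated_convergence (fun z => ‖‖z‖⁻¹ ^ 2 * f z‖) ?_ ?_
    (integrable_norm_inv_pow_mul (by norm_num) hf hs).norm ?_
  · filter_upwards [self_mem_pos] with ε hε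
    refine (Continuous.mul ?_ hf).aestronglyMeasurable
    exact continuous_pd (contDiff_iff_contDiffAt.2 fun z => contDiffAt_regKernel (by positivity)) i
  · filter_upwards [self_mem_pos] with ε hε
    filter_upwards [ae_ne_zero] with z hz
    rw [pd_regKernel (by positivity), norm_mul, norm_mul, norm_mul, norm_neg, norm_pow, norm_pow,
      norm_inv, norm_norm, Real.norm_of_nonneg (regKernel_nonneg _ _)]
    gcongr
    have h1 := regKernel_le (sq_nonneg ε) hz
    have h2 := abs_apply_le_norm z i
    have h3 := norm_pos_iff.2 hz
    calc regKernel (ε ^ 2) z ^ 3 * ‖z i‖ ≤ (‖z‖⁻¹) ^ 3 * ‖z‖ := by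
          gcongr
          · exact regKernel_nonneg _ _
          · exact h2
      _ = ‖z‖⁻¹ ^ 2 := by field_simp
  · filter_upwards [ae_ne_zero] with z hz
    refine Tendsto.mul_const _ ?_
    refine Tendsto.congr' ?_ (((tendsto_regKernel hz).pow 3).neg.mul_const (z i))
    filter_upwards [self_mem_pos] with ε hε
    rw [pd_regKernel (by positivity)]

/-- The weak derivative of the Coulomb kernel `1 / |z|` is `-z_i / |z|³`. -/
lemma integral_norm_inv_mul_pd {f : E3 → ℝ} (hf : ContDiff ℝ 1 f)
    (hs : HasCompactSupport f) (i : Fin 3) :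
    ∫ z, ‖z‖⁻¹ * pd i f z = ∫ z, (‖z‖⁻¹) ^ 3 * z i * f z := by
  have h1 := tendsto_integral_regKernel_mul (continuous_pd hf i) (hasCompactSupport_pd hs i)
  have h2 := (tendsto_integral_pd_regKernel_mul hf.continuous hs i).neg
  have h3 : (fun ε : ℝ => ∫ z, regKernel (ε ^ 2) z * pd i f z) =ᶠ[𝓝[>] 0]
      fun ε : ℝ => -∫ z, pd i (regKernel (ε ^ 2)) z * f z := by
    filter_upwards [self_mem_pos] with ε hε
    exact integral_regKernel_mul_pd (by positivity) hf hs i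
  rw [tendsto_nhds_unique (h1.congr' h3) h2, ← integral_neg]
  congr 1 with z
  ring

lemma integrable_regKernel_one_pow : Integrable (fun z : E3 => regKernel 1 z ^ 5) := by
  have h := integrable_rpow_neg_one_add_norm_sq (E := E3) (μ := volume) (r := 5) (by simp; norm_num)
  refine h.congr (Eventually.of_forall fun z => ?_)
  have h1 : (0 : ℝ) ≤ 1 + ‖z‖ ^ 2 := by positivity
  simp only [regKernel]
  rw [inv_pow, add_comm (‖z‖ ^ 2), Real.sqrt_eq_rpow, ← Real.rpow_mul_natCast h1,
    ← Real.rpow_neg h1]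
  norm_num

/-- In polar coordinates the radial integrand `3 y² (y² + 1)^{-5/2}` has the primitive `(y / √(y² +
1))³`, which increases from 0 to 1; the remaining factor is three times the volume of the unit ball.
-/
lemma integral_regKernel_one_pow : ∫ z : E3, 3 * regKernel 1 z ^ 5 = 4 * Real.pi := by
  have hint : IntegrableOn (fun y : ℝ => y ^ 2 * (3 * (Real.sqrt (y ^ 2 + 1))⁻¹ ^ 5))
      (Set.Ioi 0) := by
    have := (integrable_fun_norm_addHaar (volume : Measure E3)
      (f := fun y : ℝ => 3 * (Real.sqrt (y ^ 2 + 1))⁻¹ ^ 5)).1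
      (integrable_regKernel_one_pow.const_mul 3)
    simpa using this
  have h1 : ∫ y in Set.Ioi (0 : ℝ), y ^ 2 * (3 * (Real.sqrt (y ^ 2 + 1))⁻¹ ^ 5)
      = 1 - (0 / Real.sqrt (0 ^ 2 + 1)) ^ 3 := by
    refine integral_Ioi_of_hasDerivAt_of_tendsto
      (f := fun y : ℝ => (y / Real.sqrt (y ^ 2 + 1)) ^ 3) ?_ ?_ hint ?_
    · refine ContinuousAt.continuousWithinAt ?_
      have : Real.sqrt ((0 : ℝ) ^ 2 + 1) ≠ 0 := by simp
      have h1 : Continuous fun y : ℝ => Real.sqrt (y ^ 2 + 1) := by fun_prop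
      exact (continuousAt_id.div h1.continuousAt this).pow 3
    · intro y _
      have hs : 0 < Real.sqrt (y ^ 2 + 1) := Real.sqrt_pos.2 (by positivity)
      have h1 : HasDerivAt (fun y : ℝ => y ^ 2 + 1) (2 * y) y := by
        simpa using (hasDerivAt_pow 2 y).add_const (1 : ℝ)
      have h2 := ((hasDerivAt_id y).div (h1.sqrt (by positivity)) hs.ne').pow 3
      refine h2.congr_deriv ?_
      have h3 : Real.sqrt (y ^ 2 + 1) ^ 2 = y ^ 2 + 1 := Real.sq_sqrt (by positivity)
      simp only [Pi.div_apply, id]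
      generalize Real.sqrt (y ^ 2 + 1) = s at hs h3
      have h4 : 1 * s - y * (2 * y / (2 * s)) = 1 / s := by
        field_simp
        linarith
      rw [h4]
      norm_num
      field_simp
    · have h1 : Tendsto (fun y : ℝ => (Real.sqrt (1 + (y⁻¹) ^ 2))⁻¹ ^ 3) atTop (𝓝 1) := by
        have h2 : Tendsto (fun y : ℝ => 1 + (y⁻¹) ^ 2) atTop (𝓝 1) := by
          simpa using (tendsto_inv_atTop_zero.pow 2).const_add (1 : ℝ)
        have h3 := h2.sqrt
        rw [Real.sqrt_one] at h3
        simpa using (h3.inv₀ one_ne_zero).pow 3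
      refine h1.congr' ?_
      filter_upwards [eventually_gt_atTop 0] with y hy
      have h4 : y ^ 2 + 1 = y ^ 2 * (1 + (y⁻¹) ^ 2) := by field_simp
      rw [h4, Real.sqrt_mul (by positivity), Real.sqrt_sq hy.le]
      have : 0 < Real.sqrt (1 + (y⁻¹) ^ 2) := Real.sqrt_pos.2 (by positivity)
      field_simp
  have h2 := integral_fun_norm_addHaar (volume : Measure E3)
    (fun y : ℝ => 3 * (Real.sqrt (y ^ 2 + 1))⁻¹ ^ 5)
  have h3 : (volume : Measure E3).real (Metric.ball 0 1) = 4 / 3 * Real.pi := by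
    rw [Measure.real, EuclideanSpace.volume_ball_fin_three, ENNReal.ofReal_one, one_pow, one_mul,
      ENNReal.toReal_ofReal (by positivity)]
    ring
  unfold regKernel
  rw [h2, h3]
  simp only [finrank_euclideanSpace, Fintype.card_fin, Nat.add_one_sub_one,
    smul_eq_mul, h1, nsmul_eq_mul]
  push_cast
  ring

lemma regKernel_smul {ε : ℝ} (hε : 0 < ε) (z : E3) :
    regKernel (ε ^ 2) (ε • z) = ε⁻¹ * regKernel 1 z := by
  unfold regKernel
  rw [norm_smul, mul_pow, Real.norm_of_nonneg hε.le,
    show ε ^ 2 * ‖z‖ ^ 2 + ε ^ 2 = ε ^ 2 * (‖z‖ ^ 2 + 1) by ring, Real.sqrt_mul (by positivity),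
    Real.sqrt_sq hε.le, mul_inv]

/-- The substitution `z ↦ ε z` removes `ε` from the kernel (`ε² · ε⁻⁵ · ε³ = 1`) and moves it into
the argument of `f`. -/
lemma tendsto_integral_regKernel_pow_mul {f : E3 → ℝ} (hf : Continuous f)
    (hs : HasCompactSupport f) :
    Tendsto (fun ε : ℝ => ∫ z, 3 * ε ^ 2 * regKernel (ε ^ 2) z ^ 5 * f z) (𝓝[>] 0)
      (𝓝 (4 * Real.pi * f 0)) := by
  obtain ⟨M, hM⟩ := hs.exists_bound_of_continuous hf
  have h1 : Tendsto (fun ε : ℝ => ∫ z : E3, 3 * regKernel 1 z ^ 5 * f (ε • z)) (𝓝[>] 0)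
      (𝓝 (∫ z : E3, 3 * regKernel 1 z ^ 5 * f 0)) := by
    refine tendsto_integral_filter_of_dominated_convergence
      (fun z => 3 * regKernel 1 z ^ 5 * M) ?_ ?_
      ((integrable_regKernel_one_pow.const_mul 3).mul_const M) ?_
    · refine Eventually.of_forall fun ε => Continuous.aestronglyMeasurable ?_
      have := continuous_regKernel one_pos
      fun_prop
    · refine Eventually.of_forall fun ε => Eventually.of_forall fun z => ?_
      have := regKernel_nonneg 1 z
      rw [norm_mul, Real.norm_of_nonneg (by positivity)]
      gcongr
      exact hM _
    · refine Eventually.of_forall fun z => Tendsto.const_mul _ ?_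
      have h2 : ContinuousAt (fun ε : ℝ => f (ε • z)) 0 := by fun_prop
      have h3 := h2.tendsto
      rw [zero_smul] at h3
      exact h3.mono_left nhdsWithin_le_nhds
  rw [integral_mul_const, integral_regKernel_one_pow] at h1
  refine h1.congr' ?_
  filter_upwards [self_mem_pos] with ε hε
  have h2 := Measure.integral_comp_smul (volume : Measure E3)
    (fun z => 3 * ε ^ 2 * regKernel (ε ^ 2) z ^ 5 * f z) ε
  rw [finrank_euclideanSpace, Fintype.card_fin, abs_of_pos (by positivity), smul_eq_mul] at h2
  rw [← mul_right_inj' (a := (ε ^ 3)⁻¹) (by positivity), ← h2, ← integral_const_mul]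
  congr 1 with z
  rw [regKernel_smul hε]
  field_simp

/-- `-1 / (4π|z|)` is a fundamental solution of the Laplacian. -/
lemma integral_norm_inv_mul_laplacian {f : E3 → ℝ} (hf : ContDiff ℝ (⊤ : ℕ∞) f)
    (hs : HasCompactSupport f) :
    ∑ i, ∫ z, ‖z‖⁻¹ * pd i (pd i f) z = -(4 * Real.pi) * f 0 := by
  have h1 : Tendsto (fun ε : ℝ => ∑ i, ∫ z, regKernel (ε ^ 2) z * pd i (pd i f) z) (𝓝[>] 0)
      (𝓝 (∑ i, ∫ z, ‖z‖⁻¹ * pd i (pd i f) z)) :=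
    tendsto_finsetSum _ fun i _ => tendsto_integral_regKernel_mul
      (contDiff_pd (contDiff_pd hf i) i).continuous (hasCompactSupport_pd (hasCompactSupport_pd hs i) i)
  have h2 := (tendsto_integral_regKernel_pow_mul hf.continuous hs).neg
  rw [← neg_mul] at h2
  refine tendsto_nhds_unique (h1.congr' ?_) h2
  filter_upwards [self_mem_pos] with ε hε
  have hc : 0 < ε ^ 2 := by positivity
  have hN : ContDiff ℝ (⊤ : ℕ∞) (regKernel (ε ^ 2)) :=
    contDiff_iff_contDiffAt.2 fun z => contDiffAt_regKernel (by positivity)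
  have hint : ∀ i, Integrable fun z => pd i (pd i (regKernel (ε ^ 2))) z * f z := fun i =>
    ((contDiff_pd (contDiff_pd hN i) i).continuous.mul hf.continuous).integrable_of_hasCompactSupport
      hs.mul_left
  have h3 : ∀ i, ∫ z, regKernel (ε ^ 2) z * pd i (pd i f) z
      = ∫ z, pd i (pd i (regKernel (ε ^ 2))) z * f z := fun i => by
    have hfi := contDiff_pd hf i
    have hNi := contDiff_pd hN i
    have hsi := hasCompactSupport_pd hs i
    rw [integral_regKernel_mul_pd hc (hfi.of_le (by simp)) hsi, neg_eq_iff_eq_neg]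
    refine integral_mul_fderiv_eq_neg_fderiv_mul_of_integrable (hint i) ?_ ?_
      (fun x _ => hNi.differentiable (by simp) x) (fun x _ => hf.differentiable (by simp) x)
    · exact (hNi.continuous.mul hfi.continuous).integrable_of_hasCompactSupport hsi.mul_left
    · exact (hNi.continuous.mul hf.continuous).integrable_of_hasCompactSupport hs.mul_left
  rw [Finset.sum_congr rfl fun i _ => h3 i, ← integral_finsetSum _ fun i _ => hint i,
    ← integral_neg]
  congr 1 with z
  rw [← Finset.sum_mul, sum_pd_pd_regKernel (by positivity)]
  ring

/-! ### Coulomb potentials of compactly supported densities. -/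

/-- The potential `∫ f(y) / |x - y| dy`, written as a convolution. -/
def coulomb (f : E3 → ℝ) (x : E3) : ℝ := ∫ z, ‖z‖⁻¹ * f (x - z)

lemma coulomb_eq_convolution (f : E3 → ℝ) :
    coulomb f = (MeasureTheory.convolution (fun z : E3 => ‖z‖⁻¹) f
      (ContinuousLinearMap.mul ℝ ℝ) volume) := by
  ext x
  rfl

lemma locallyIntegrable_norm_inv : LocallyIntegrable (fun z : E3 => ‖z‖⁻¹) := by
  simpa using locallyIntegrable_norm_inv_pow (k := 1) (by norm_num)

lemma contDiff_coulomb {f : E3 → ℝ} (hf : ContDiff ℝ (⊤ : ℕ∞) f) (hs : HasCompactSupport f) :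
    ContDiff ℝ (⊤ : ℕ∞) (coulomb f) := by
  rw [coulomb_eq_convolution]
  exact hs.contDiff_convolution_right _ locallyIntegrable_norm_inv hf

lemma pd_coulomb {f : E3 → ℝ} (hf : ContDiff ℝ 1 f) (hs : HasCompactSupport f) (i : Fin 3) :
    pd i (coulomb f) = coulomb (pd i f) := by
  ext x
  have h := hs.hasFDerivAt_convolution_right (ContinuousLinearMap.mul ℝ ℝ)
    locallyIntegrable_norm_inv hf x
  rw [← coulomb_eq_convolution] at h
  unfold pd
  rw [h.fderiv]
  unfold coulomb MeasureTheory.convolution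
  rw [ContinuousLinearMap.integral_apply]
  · rfl
  · exact (hs.fderiv ℝ).convolutionExists_right _ locallyIntegrable_norm_inv
      (hf.continuous_fderiv one_ne_zero) x

lemma pd_comp_sub_left (f : E3 → ℝ) (x z : E3) (i : Fin 3) :
    pd i (fun z => f (x - z)) z = - pd i f (x - z) := by
  unfold pd
  have := fderiv_comp_smul (f := fun z => f (x + z)) (x := z) (-1 : ℝ)
  simp only [neg_one_smul, ← sub_eq_add_neg] at this
  rw [this, fderiv_comp_add_left, sub_eq_add_neg]
  rfl

lemma hasCompactSupport_comp_sub_left {f : E3 → ℝ} (hs : HasCompactSupport f) (x : E3) :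
    HasCompactSupport fun z => f (x - z) :=
  hs.comp_homeomorph (Homeomorph.subLeft x)

lemma integrable_kernel_mul {f : E3 → ℝ} (hf : Continuous f) (hs : HasCompactSupport f)
    (x : E3) (i : Fin 3) :
    Integrable fun y => (‖x - y‖⁻¹) ^ 3 * (x - y) i * f y := by
  have h := integrable_norm_inv_pow_mul (k := 2) (by norm_num) (f := fun z => f (x - z))
    (by fun_prop) (hasCompactSupport_comp_sub_left hs x)
  have h2 : Integrable fun z : E3 => ‖z‖⁻¹ ^ 3 * z i * f (x - z) := by
    refine h.mono (by fun_prop) (Eventually.of_forall fun z => ?_)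
    rw [norm_mul, norm_mul, norm_mul]
    gcongr
    rcases eq_or_ne z 0 with rfl | hz
    · simp
    rw [norm_pow, norm_pow, norm_inv, norm_norm]
    have := norm_pos_iff.2 hz
    calc ‖z‖⁻¹ ^ 3 * ‖z i‖ ≤ (‖z‖⁻¹) ^ 3 * ‖z‖ := by
          gcongr
          exact abs_apply_le_norm z i
      _ = ‖z‖⁻¹ ^ 2 := by field_simp
  simpa using h2.comp_sub_left x

lemma pd_coulomb_apply {f : E3 → ℝ} (hf : ContDiff ℝ 1 f) (hs : HasCompactSupport f) (i : Fin 3)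
    (x : E3) : pd i (coulomb f) x = - ∫ y, (‖x - y‖⁻¹) ^ 3 * (x - y) i * f y := by
  rw [pd_coulomb hf hs, coulomb]
  have hx : ContDiff ℝ 1 fun z => f (x - z) := hf.comp (contDiff_const.sub contDiff_id)
  have h := integral_norm_inv_mul_pd hx (hasCompactSupport_comp_sub_left hs x) i
  simp only [pd_comp_sub_left, mul_neg, integral_neg] at h
  rw [← neg_inj, h, neg_neg,
    ← integral_sub_left_eq_self (fun y => ‖x - y‖⁻¹ ^ 3 * (x - y) i * f y) volume x]
  simp

lemma sum_pd_pd_coulomb {f : E3 → ℝ} (hf : ContDiff ℝ (⊤ : ℕ∞) f) (hs : HasCompactSupport f)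
    (x : E3) : ∑ i, pd i (pd i (coulomb f)) x = -(4 * Real.pi) * f x := by
  have hx : ContDiff ℝ (⊤ : ℕ∞) fun z => f (x - z) := hf.comp (contDiff_const.sub contDiff_id)
  have h := integral_norm_inv_mul_laplacian hx (hasCompactSupport_comp_sub_left hs x)
  rw [sub_zero] at h
  rw [← h]
  refine Finset.sum_congr rfl fun i _ => ?_
  rw [pd_coulomb (hf.of_le (by simp)) hs, pd_coulomb ((contDiff_pd hf i).of_le (by simp))
    (hasCompactSupport_pd hs i), coulomb]
  congr 1 with z
  have : pd i (fun z => f (x - z)) = fun z => -pd i f (x - z) := by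
    ext z; exact pd_comp_sub_left f x z i
  rw [this]
  have h2 : pd i (fun z => -pd i f (x - z)) z = - pd i (fun z => pd i f (x - z)) z := by
    unfold pd
    rw [fderiv_fun_neg]
    rfl
  rw [h2, pd_comp_sub_left, neg_neg]

/-! ### Potentials of densities supported far away. -/

section FarField

variable {F : Type} [NormedAddCommGroup F] [NormedSpace ℝ F]

/-- `w` vanishes on the ball of radius `R` about the origin, and `∫ |w(y)| / |y|³ dy < ∞`. -/
structure IsFarDensity (w : E3 → ℝ) (R : ℝ) : Prop where
  pos : 0 < R
  aesm : AEStronglyMeasurable w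
  zero : ∀ y, ‖y‖ < R → w y = 0
  integrable : Integrable fun y => w y * (‖y‖⁻¹) ^ 3

variable {w : E3 → ℝ} {R : ℝ}

lemma IsFarDensity.integrable_smul (hw : IsFarDensity w R) {g : E3 → F} {C : ℝ}
    (hg : AEStronglyMeasurable g) (hb : ∀ y, R ≤ ‖y‖ → ‖g y‖ ≤ C * (‖y‖⁻¹) ^ 3) :
    Integrable fun y => w y • g y := by
  refine (hw.integrable.norm.const_mul C).mono' (hw.aesm.smul hg) (Eventually.of_forall fun y => ?_)
  rcases lt_or_ge ‖y‖ R with h | h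
  · simp [hw.zero y h]
  · rw [norm_smul, norm_mul, norm_pow, norm_inv, norm_norm, mul_left_comm]
    gcongr
    exact hb y h

lemma IsFarDensity.hasFDerivAt_integral (hw : IsFarDensity w R) {G : E3 → E3 → F}
    {G' : E3 → E3 → E3 →L[ℝ] F} {C C' : ℝ}
    (hGm : ∀ x, AEStronglyMeasurable (G x)) (hGm' : ∀ x, AEStronglyMeasurable (G' x))
    (hG : ∀ x y, ‖x‖ < R / 2 → R ≤ ‖y‖ → HasFDerivAt (G · y) (G' x y) x)
    (hb : ∀ x y, ‖x‖ < R / 2 → R ≤ ‖y‖ → ‖G x y‖ ≤ C * (‖y‖⁻¹) ^ 3)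
    (hb' : ∀ x y, ‖x‖ < R / 2 → R ≤ ‖y‖ → ‖G' x y‖ ≤ C' * (‖y‖⁻¹) ^ 3) {x : E3}
    (hx : ‖x‖ < R / 2) :
    HasFDerivAt (fun x => ∫ y, w y • G x y) (∫ y, w y • G' x y) x := by
  have hs : Metric.ball (0 : E3) (R / 2) ∈ 𝓝 x :=
    Metric.isOpen_ball.mem_nhds (by simpa using hx)
  refine hasFDerivAt_integral_of_dominated_of_fderiv_le (F' := fun x y => w y • G' x y)
    (bound := fun y => C' * ‖w y * (‖y‖⁻¹) ^ 3‖) hs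
    (Eventually.of_forall fun x => hw.aesm.smul (hGm x))
    (hw.integrable_smul (hGm x) fun y => hb x y hx)
    (hw.aesm.smul (hGm' x)) ?_
    (hw.integrable.norm.const_mul C') ?_
  · refine Eventually.of_forall fun y z hz => ?_
    rw [mem_ball_zero_iff] at hz
    rcases lt_or_ge ‖y‖ R with h | h
    · simp [hw.zero y h]
    · rw [norm_smul, norm_mul, norm_pow, norm_inv, norm_norm, mul_left_comm]
      gcongr
      exact hb' z y hz h
  · refine Eventually.of_forall fun y z hz => ?_
    rw [mem_ball_zero_iff] at hz
    rcases lt_or_ge ‖y‖ R with h | h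
    · simpa [hw.zero y h] using hasFDerivAt_const (0 : F) z
    · exact (hG z y hz h).const_smul (w y)

/-- If `G(0, y) = 0`, a bound on the derivative of `G(·, y)` yields one on `G(·, y)`. -/
lemma norm_le_of_hasFDerivAt_of_zero {G : E3 → F} {G' : E3 → E3 →L[ℝ] F} {C : ℝ}
    (hG : ∀ x, ‖x‖ < R / 2 → HasFDerivAt G (G' x) x) (h0 : G 0 = 0)
    (hb : ∀ x, ‖x‖ < R / 2 → ‖G' x‖ ≤ C) {x : E3} (hx : ‖x‖ < R / 2) :
    ‖G x‖ ≤ R / 2 * C := by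
  have hR : 0 < R / 2 := (norm_nonneg x).trans_lt hx
  have hC : 0 ≤ C := (norm_nonneg _).trans (hb x hx)
  have h := (convex_ball (0 : E3) (R / 2)).norm_image_sub_le_of_norm_hasFDerivWithin_le (C := C)
    (f := G) (f' := G') (x := 0) (y := x)
    (fun z hz => (hG z (by simpa using hz)).hasFDerivWithinAt)
    (fun z hz => hb z (by simpa using hz)) (by simpa using hR) (by simpa using hx)
  rw [h0, sub_zero, sub_zero] at h
  calc ‖G x‖ ≤ C * ‖x‖ := h
    _ ≤ C * (R / 2) := by gcongr
    _ = R / 2 * C := mul_comm _ _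

/-- A kernel which is smooth off the origin and homogeneous of degree `-m`. -/
structure IsHomKernel (K : E3 → F) (m : ℕ) : Prop where
  smooth : ∀ z, z ≠ 0 → ContDiffAt ℝ (⊤ : ℕ∞) K z
  hom : ∀ (t : ℝ) (z : E3), 0 < t → z ≠ 0 → K (t • z) = (t⁻¹) ^ m • K z

variable {K : E3 → F} {m : ℕ}

lemma IsHomKernel.aestronglyMeasurable (hK : IsHomKernel K m) : AEStronglyMeasurable K := by
  have h : ContinuousOn K {0}ᶜ := fun z hz => (hK.smooth z hz).continuousAt.continuousWithinAt
  have := h.aestronglyMeasurable (μ := volume) (measurableSet_singleton (0 : E3)).compl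
  rwa [restrict_compl_singleton] at this

lemma IsHomKernel.aestronglyMeasurable_sub (hK : IsHomKernel K m) (x : E3) :
    AEStronglyMeasurable fun y => K (x - y) :=
  hK.aestronglyMeasurable.comp_quasiMeasurePreserving
    (Measure.measurePreserving_sub_left volume x).quasiMeasurePreserving

lemma IsHomKernel.exists_bound (hK : IsHomKernel K m) :
    ∃ C, 0 ≤ C ∧ ∀ z, z ≠ 0 → ‖K z‖ ≤ C * (‖z‖⁻¹) ^ m := by
  have hc : ContinuousOn K (Metric.sphere 0 1) := fun z hz =>
    (hK.smooth z (Metric.ne_of_mem_sphere hz one_ne_zero)).continuousAt.continuousWithinAt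
  obtain ⟨C, hC⟩ := (isCompact_sphere (0 : E3) 1).exists_bound_of_continuousOn hc
  refine ⟨max C 0, le_max_right _ _, fun z hz => ?_⟩
  have hz' := norm_pos_iff.2 hz
  have hu : ‖(‖z‖⁻¹ • z : E3)‖ = 1 := by
    rw [norm_smul, norm_inv, norm_norm, inv_mul_cancel₀ hz'.ne']
  have h := hK.hom ‖z‖ (‖z‖⁻¹ • z) hz' (norm_ne_zero_iff.1 (by rw [hu]; exact one_ne_zero))
  rw [smul_smul, mul_inv_cancel₀ hz'.ne', one_smul] at h
  rw [h, norm_smul, norm_pow, norm_inv, norm_norm, mul_comm]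
  gcongr
  exact (hC _ (by simpa using hu)).trans (le_max_left _ _)

lemma IsHomKernel.fderiv_kernel (hK : IsHomKernel K m) : IsHomKernel (fderiv ℝ K) (m + 1) where
  smooth z hz := (hK.smooth z hz).fderiv_right (by simp)
  hom t z ht hz := by
    have h1 : (fun y => K (t • y)) =ᶠ[𝓝 z] fun y => (t⁻¹) ^ m • K y :=
      (isOpen_ne.eventually_mem hz).mono fun y hy => hK.hom t y ht hy
    have h2 := h1.fderiv_eq (𝕜 := ℝ)
    rw [fderiv_comp_smul, fderiv_fun_const_smul ((hK.smooth z hz).differentiableAt (by simp))] at h2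
    rw [← inv_smul_smul₀ ht.ne' (fderiv ℝ K (t • z)), h2, smul_smul, pow_succ, mul_comm]

lemma half_norm_le_norm_sub {x y : E3} (hx : ‖x‖ < R / 2) (hy : R ≤ ‖y‖) : ‖y‖ / 2 ≤ ‖x - y‖ := by
  have := norm_sub_norm_le y x
  rw [norm_sub_rev] at this
  linarith

/-- In this region `|x - y| ≥ |y| / 2`, and the powers of `|y|⁻¹` beyond the third are absorbed into
powers of `R⁻¹`. -/
lemma IsHomKernel.norm_sub_le (hK : IsHomKernel K m) (hm : 3 ≤ m) (hR : 0 < R) :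
    ∃ C, ∀ x y, ‖x‖ < R / 2 → R ≤ ‖y‖ → ‖K (x - y)‖ ≤ C * (‖y‖⁻¹) ^ 3 := by
  obtain ⟨C, hC0, hC⟩ := hK.exists_bound
  obtain ⟨k, rfl⟩ := Nat.exists_eq_add_of_le hm
  refine ⟨C * 2 ^ (3 + k) * (R⁻¹) ^ k, fun x y hx hy => ?_⟩
  have h := half_norm_le_norm_sub hx hy
  have hy0 : 0 < ‖y‖ := hR.trans_le hy
  have hxy : 0 < ‖x - y‖ := by linarith
  calc ‖K (x - y)‖ ≤ C * (‖x - y‖⁻¹) ^ (3 + k) := hC _ (norm_pos_iff.1 hxy)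
    _ ≤ C * ((‖y‖ / 2)⁻¹) ^ (3 + k) := by gcongr
    _ = C * 2 ^ (3 + k) * (‖y‖⁻¹) ^ k * (‖y‖⁻¹) ^ 3 := by
        rw [inv_div, div_eq_mul_inv, mul_pow, pow_add (‖y‖⁻¹)]; ring
    _ ≤ C * 2 ^ (3 + k) * (R⁻¹) ^ k * (‖y‖⁻¹) ^ 3 := by gcongr

lemma sub_ne_zero_of_far (hR : 0 < R) {x y : E3} (hx : ‖x‖ < R / 2) (hy : R ≤ ‖y‖) :
    x - y ≠ 0 := by
  have := half_norm_le_norm_sub hx hy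
  exact norm_pos_iff.1 (by linarith)

lemma IsHomKernel.hasFDerivAt_sub (hK : IsHomKernel K m) (hR : 0 < R) {x y : E3}
    (hx : ‖x‖ < R / 2) (hy : R ≤ ‖y‖) :
    HasFDerivAt (fun x => K (x - y)) (fderiv ℝ K (x - y)) x := by
  have h := ((hK.smooth _ (sub_ne_zero_of_far hR hx hy)).differentiableAt (by simp)).hasFDerivAt
  exact HasFDerivAt.comp x h ((hasFDerivAt_id x).sub_const y)

lemma IsFarDensity.hasFDerivAt_homKernel (hw : IsFarDensity w R) (hK : IsHomKernel K m)
    (hm : 3 ≤ m) {x : E3} (hx : ‖x‖ < R / 2) :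
    HasFDerivAt (fun x => ∫ y, w y • K (x - y)) (∫ y, w y • fderiv ℝ K (x - y)) x := by
  obtain ⟨C, hC⟩ := hK.norm_sub_le hm hw.pos
  obtain ⟨C', hC'⟩ := hK.fderiv_kernel.norm_sub_le (by omega) hw.pos
  exact hw.hasFDerivAt_integral (hK.aestronglyMeasurable_sub ·)
    (hK.fderiv_kernel.aestronglyMeasurable_sub ·) (fun x y hx hy => hK.hasFDerivAt_sub hw.pos hx hy)
    hC hC' hx

/-- Each derivative of a homogeneous kernel is again homogeneous, of degree one lower, but takes
values in another space; the induction therefore runs over all `F`, `K` and `m` at once. -/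
lemma IsFarDensity.contDiffOn_homKernel (hw : IsFarDensity w R) (n : ℕ) :
    ∀ {F : Type} [NormedAddCommGroup F] [NormedSpace ℝ F] {K : E3 → F} {m : ℕ},
      IsHomKernel K m → 3 ≤ m →
      ContDiffOn ℝ n (fun x => ∫ y, w y • K (x - y)) (Metric.ball 0 (R / 2)) := by
  induction n with
  | zero =>
    intro F _ _ K m hK hm
    refine contDiffOn_zero.2 fun x hx => ?_
    exact (hw.hasFDerivAt_homKernel hK hm (by simpa using hx)).continuousAt.continuousWithinAt
  | succ n ih =>
    intro F _ _ K m hK hm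
    push_cast
    rw [contDiffOn_succ_iff_fderiv_of_isOpen Metric.isOpen_ball]
    refine ⟨fun x hx => (hw.hasFDerivAt_homKernel hK hm
      (by simpa using hx)).differentiableAt.differentiableWithinAt, by simp, ?_⟩
    exact (ih hK.fderiv_kernel (by omega)).congr fun x hx =>
      (hw.hasFDerivAt_homKernel hK hm (by simpa using hx)).fderiv

end FarField

lemma isHomKernel_norm_inv : IsHomKernel (regKernel 0) 1 where
  smooth z hz := contDiffAt_regKernel (by have := norm_pos_iff.2 hz; positivity)
  hom t z ht hz := by
    simp only [regKernel_zero]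
    rw [norm_smul, Real.norm_of_nonneg ht.le, mul_inv, pow_one, smul_eq_mul]

/-! ### The Taylor-subtracted Coulomb kernel. -/

section

variable {w : E3 → ℝ} {R : ℝ}

/-- The Coulomb kernel with its first-order Taylor polynomial at `x = 0` subtracted. -/
def farKernel (x y : E3) : ℝ := ‖x - y‖⁻¹ - (‖y‖⁻¹ + (‖y‖⁻¹) ^ 3 * inner ℝ x y)

/-- The potential with kernel `farKernel`. -/
def farPotential (w : E3 → ℝ) (x : E3) : ℝ := ∫ y, w y * farKernel x y

/-- The derivative of `farKernel` in its first argument. -/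
def farKernel' (x y : E3) : E3 →L[ℝ] ℝ :=
  fderiv ℝ (regKernel 0) (x - y) - (‖y‖⁻¹) ^ 3 • innerSL ℝ y

lemma fderiv_regKernel_zero {z : E3} (hz : z ≠ 0) :
    fderiv ℝ (regKernel 0) z = (-(‖z‖⁻¹) ^ 3) • innerSL ℝ z := by
  rw [(hasFDerivAt_regKernel (by have := norm_pos_iff.2 hz; positivity)).fderiv, regKernel_zero]

lemma hasFDerivAt_farKernel (hR : 0 < R) {x y : E3} (hx : ‖x‖ < R / 2) (hy : R ≤ ‖y‖) :
    HasFDerivAt (farKernel · y) (farKernel' x y) x := by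
  have h1 := isHomKernel_norm_inv.hasFDerivAt_sub hR hx hy
  simp only [regKernel_zero] at h1
  have h2 : HasFDerivAt (fun x : E3 => ‖y‖⁻¹ + (‖y‖⁻¹) ^ 3 * inner ℝ x y)
      ((‖y‖⁻¹) ^ 3 • innerSL ℝ y) x := by
    have h3 : HasFDerivAt (fun x : E3 => inner ℝ x y) (innerSL ℝ y) x := by
      have := (innerSL ℝ y).hasFDerivAt (x := x)
      refine this.congr_of_eventuallyEq (Eventually.of_forall fun z => ?_)
      simp [real_inner_comm]
    exact (h3.const_mul _).const_add _
  exact h1.sub h2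

lemma hasFDerivAt_farKernel' (hR : 0 < R) {x y : E3} (hx : ‖x‖ < R / 2) (hy : R ≤ ‖y‖) :
    HasFDerivAt (farKernel' · y) (fderiv ℝ (fderiv ℝ (regKernel 0)) (x - y)) x :=
  (isHomKernel_norm_inv.fderiv_kernel.hasFDerivAt_sub hR hx hy).sub_const _

lemma farKernel_zero (y : E3) : farKernel 0 y = 0 := by
  simp [farKernel]

lemma farKernel'_zero {y : E3} (hy : y ≠ 0) : farKernel' 0 y = 0 := by
  unfold farKernel'
  rw [zero_sub, fderiv_regKernel_zero (neg_ne_zero.2 hy), norm_neg, map_neg, smul_neg, neg_smul,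
    neg_neg, sub_self]

/-- The second derivative in `x` is homogeneous of degree -3. The kernel and its first derivative
vanish at `x = 0`, so applying the mean value inequality twice carries the same decay down to them.
-/
lemma exists_bound_farKernel (hR : 0 < R) : ∃ C C' C'' : ℝ,
    (∀ x y : E3, ‖x‖ < R / 2 → R ≤ ‖y‖ → ‖farKernel x y‖ ≤ C * (‖y‖⁻¹) ^ 3) ∧
    (∀ x y : E3, ‖x‖ < R / 2 → R ≤ ‖y‖ → ‖farKernel' x y‖ ≤ C' * (‖y‖⁻¹) ^ 3) ∧
    (∀ x y : E3, ‖x‖ < R / 2 → R ≤ ‖y‖ →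
      ‖fderiv ℝ (fderiv ℝ (regKernel 0)) (x - y)‖ ≤ C'' * (‖y‖⁻¹) ^ 3) := by
  obtain ⟨C, hC⟩ := isHomKernel_norm_inv.fderiv_kernel.fderiv_kernel.norm_sub_le le_rfl hR
  have h1 : ∀ x y : E3, ‖x‖ < R / 2 → R ≤ ‖y‖ → ‖farKernel' x y‖ ≤ R / 2 * C * (‖y‖⁻¹) ^ 3 := by
    intro x y hx hy
    rw [mul_assoc]
    exact norm_le_of_hasFDerivAt_of_zero (fun x hx => hasFDerivAt_farKernel' hR hx hy)
      (farKernel'_zero (norm_pos_iff.1 (hR.trans_le hy))) (fun x hx => hC x y hx hy) hx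
  refine ⟨R / 2 * (R / 2 * C), R / 2 * C, C, fun x y hx hy => ?_, h1, hC⟩
  rw [mul_assoc]
  exact norm_le_of_hasFDerivAt_of_zero (fun x hx => hasFDerivAt_farKernel hR hx hy)
    (farKernel_zero y) (fun x hx => h1 x y hx hy) hx

lemma aestronglyMeasurable_farKernel (x : E3) : AEStronglyMeasurable (farKernel x) := by
  unfold farKernel
  fun_prop

lemma aestronglyMeasurable_farKernel' (x : E3) : AEStronglyMeasurable (farKernel' x) := by
  refine (isHomKernel_norm_inv.fderiv_kernel.aestronglyMeasurable_sub x).sub ?_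
  refine AEStronglyMeasurable.smul (f := fun y : E3 => (‖y‖⁻¹) ^ 3) (by fun_prop) ?_
  exact (innerSL ℝ).continuous.aestronglyMeasurable

lemma IsFarDensity.integrable_farKernel (hw : IsFarDensity w R) {x : E3} (hx : ‖x‖ < R / 2) :
    Integrable fun y => w y * farKernel x y := by
  obtain ⟨C, C', C'', h1, h2, h3⟩ := exists_bound_farKernel hw.pos
  exact hw.integrable_smul (aestronglyMeasurable_farKernel x) fun y => h1 x y hx

lemma IsFarDensity.integrable_farKernel' (hw : IsFarDensity w R) {x : E3} (hx : ‖x‖ < R / 2) :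
    Integrable fun y => w y • farKernel' x y := by
  obtain ⟨C, C', C'', h1, h2, h3⟩ := exists_bound_farKernel hw.pos
  exact hw.integrable_smul (aestronglyMeasurable_farKernel' x) fun y => h2 x y hx

lemma IsFarDensity.hasFDerivAt_farPotential (hw : IsFarDensity w R) {x : E3} (hx : ‖x‖ < R / 2) :
    HasFDerivAt (farPotential w) (∫ y, w y • farKernel' x y) x := by
  obtain ⟨C, C', C'', h1, h2, h3⟩ := exists_bound_farKernel hw.pos
  exact hw.hasFDerivAt_integral aestronglyMeasurable_farKernel aestronglyMeasurable_farKernel'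
    (fun x y hx hy => hasFDerivAt_farKernel hw.pos hx hy) h1 h2 hx

lemma IsFarDensity.hasFDerivAt_fderiv_farPotential (hw : IsFarDensity w R) {x : E3}
    (hx : ‖x‖ < R / 2) :
    HasFDerivAt (fun x => ∫ y, w y • farKernel' x y)
      (∫ y, w y • fderiv ℝ (fderiv ℝ (regKernel 0)) (x - y)) x := by
  obtain ⟨C, C', C'', h1, h2, h3⟩ := exists_bound_farKernel hw.pos
  exact hw.hasFDerivAt_integral aestronglyMeasurable_farKernel'
    isHomKernel_norm_inv.fderiv_kernel.fderiv_kernel.aestronglyMeasurable_sub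
    (fun x y hx hy => hasFDerivAt_farKernel' hw.pos hx hy) h2 h3 hx

lemma IsFarDensity.contDiffOn_farPotential (hw : IsFarDensity w R) :
    ContDiffOn ℝ (⊤ : ℕ∞) (farPotential w) (Metric.ball 0 (R / 2)) := by
  -- The first two derivatives are peeled off by hand, since the Taylor terms spoil homogeneity;
  -- after two derivatives these terms are gone and the result for homogeneous kernels applies.
  refine contDiffOn_infty.2 fun n => ContDiffOn.of_le (n := ((n + 1 : ℕ) + 1 : ℕ)) ?_
    (by norm_cast; omega)
  push_cast
  rw [contDiffOn_succ_iff_fderiv_of_isOpen Metric.isOpen_ball]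
  refine ⟨fun x hx => (hw.hasFDerivAt_farPotential
    (by simpa using hx)).differentiableAt.differentiableWithinAt, by simp, ?_⟩
  refine ContDiffOn.congr ?_ fun x hx => (hw.hasFDerivAt_farPotential (by simpa using hx)).fderiv
  rw [contDiffOn_succ_iff_fderiv_of_isOpen Metric.isOpen_ball]
  refine ⟨fun x hx => (hw.hasFDerivAt_fderiv_farPotential
    (by simpa using hx)).differentiableAt.differentiableWithinAt, by simp, ?_⟩
  refine ContDiffOn.congr ?_
    fun x hx => (hw.hasFDerivAt_fderiv_farPotential (by simpa using hx)).fderiv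
  exact hw.contDiffOn_homKernel n isHomKernel_norm_inv.fderiv_kernel.fderiv_kernel le_rfl

lemma IsFarDensity.pd_farPotential (hw : IsFarDensity w R) {x : E3} (hx : ‖x‖ < R / 2)
    (i : Fin 3) :
    pd i (farPotential w) x = ∫ y, w y * (farKernel' x y (EuclideanSpace.single i 1)) := by
  unfold pd
  rw [(hw.hasFDerivAt_farPotential hx).fderiv,
    ContinuousLinearMap.integral_apply (hw.integrable_farKernel' hx)]
  rfl

/-- The Taylor polynomial has no second derivatives, and `1 / |x - y|` is harmonic in `x` for almost
every `y`. -/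
lemma IsFarDensity.sum_pd_pd_farPotential (hw : IsFarDensity w R) {x : E3} (hx : ‖x‖ < R / 2) :
    ∑ i, pd i (pd i (farPotential w)) x = 0 := by
  obtain ⟨C, C', C'', h1, h2, h3⟩ := exists_bound_farKernel hw.pos
  have hK := isHomKernel_norm_inv.fderiv_kernel
  have hint := hw.integrable_smul (hK.fderiv_kernel.aestronglyMeasurable_sub x)
    fun y => h3 x y hx
  have hae : ∀ᵐ y : E3, x - y ≠ 0 :=
    (Measure.measurePreserving_sub_left volume x).quasiMeasurePreserving.ae ae_ne_zero
  have hcongr : ∀ i, (fun y => (w y • fderiv ℝ (fderiv ℝ (regKernel 0)) (x - y))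
      (EuclideanSpace.single i 1) (EuclideanSpace.single i 1)) =ᵐ[volume]
      fun y => w y * pd i (pd i (regKernel 0)) (x - y) := by
    intro i
    filter_upwards [hae] with y hy
    have hd2 := ((hK.smooth _ hy).differentiableAt (by simp)).hasFDerivAt.clm_apply
      (hasFDerivAt_const (EuclideanSpace.single i (1 : ℝ) : E3) (x - y))
    have : pd i (pd i (regKernel 0)) (x - y) = fderiv ℝ (fun z => fderiv ℝ (regKernel 0) z
      (EuclideanSpace.single i 1)) (x - y) (EuclideanSpace.single i 1) := rfl
    rw [this, hd2.fderiv]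
    simp
  have hint1 : ∀ i, Integrable fun y => (w y • fderiv ℝ (fderiv ℝ (regKernel 0)) (x - y))
      (EuclideanSpace.single i 1) := fun i => hint.apply_continuousLinearMap _
  have hint2 : ∀ i, Integrable fun y => w y * pd i (pd i (regKernel 0)) (x - y) := fun i =>
    ((hint1 i).apply_continuousLinearMap _).congr (hcongr i)
  have hpd : ∀ i, pd i (pd i (farPotential w)) x
      = ∫ y, w y * pd i (pd i (regKernel 0)) (x - y) := by
    intro i
    have he : pd i (farPotential w) =ᶠ[𝓝 x]
        fun x => (∫ y, w y • farKernel' x y) (EuclideanSpace.single i 1) := by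
      filter_upwards [Metric.isOpen_ball.mem_nhds
        (show x ∈ Metric.ball 0 (R / 2) by simpa using hx)] with z hz
      unfold pd
      rw [(hw.hasFDerivAt_farPotential (by simpa using hz)).fderiv]
    have hd := (hw.hasFDerivAt_fderiv_farPotential hx).clm_apply
      (hasFDerivAt_const (EuclideanSpace.single i (1 : ℝ) : E3) x)
    have : pd i (pd i (farPotential w)) x
        = fderiv ℝ (pd i (farPotential w)) x (EuclideanSpace.single i 1) := rfl
    rw [this, he.fderiv_eq, hd.fderiv]
    simp only [ContinuousLinearMap.comp_zero, zero_add, ContinuousLinearMap.flip_apply]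
    rw [ContinuousLinearMap.integral_apply hint, ContinuousLinearMap.integral_apply (hint1 i)]
    exact integral_congr_ae (hcongr i)
  rw [Finset.sum_congr rfl fun i _ => hpd i, ← integral_finsetSum _ fun i _ => hint2 i]
  refine integral_eq_zero_of_ae ?_
  filter_upwards [hae] with y hy
  have hy' : 0 < ‖x - y‖ ^ 2 + 0 := by have := norm_pos_iff.2 hy; positivity
  rw [← Finset.mul_sum, sum_pd_pd_regKernel hy']
  simp

end

/-! ### Local representation of the inverse Laplacian. -/

lemma coulomb_eq (f : E3 → ℝ) (x : E3) : coulomb f x = ∫ y, f y * ‖x - y‖⁻¹ := by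
  rw [coulomb, ← integral_sub_left_eq_self (fun y => f y * ‖x - y‖⁻¹) volume x]
  simp [mul_comm]

lemma integrable_mul_norm_sub_inv {f : E3 → ℝ} (hf : Continuous f) (hs : HasCompactSupport f)
    (x : E3) : Integrable fun y => f y * ‖x - y‖⁻¹ := by
  have h := integrable_norm_inv_pow_mul (k := 1) (by norm_num) (f := fun z => f (x - z))
    (by fun_prop) (hasCompactSupport_comp_sub_left hs x)
  simpa [mul_comm] using h.comp_sub_left x

/-- The integral of the Taylor polynomial of the kernel is an affine function. -/
lemma exists_affine {f : E3 → ℝ} (hm : AEStronglyMeasurable f) (h0 : ∀ y, ‖y‖ < 1 → f y = 0)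
    (hf : Integrable fun y => f y * ‖y‖⁻¹) :
    ∃ (a : ℝ) (b : E3), ∀ x : E3,
      Integrable (fun y => f y * (‖y‖⁻¹ + (‖y‖⁻¹) ^ 3 * inner ℝ x y)) ∧
      ∫ y, f y * (‖y‖⁻¹ + (‖y‖⁻¹) ^ 3 * inner ℝ x y) = a + inner ℝ x b := by
  have h1 : Integrable fun y : E3 => (f y * (‖y‖⁻¹) ^ 3) • y := by
    refine hf.norm.mono' (AEStronglyMeasurable.smul (f := fun y => f y * (‖y‖⁻¹) ^ 3)
      (hm.mul (by fun_prop)) (by fun_prop)) (Eventually.of_forall fun y => ?_)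
    rcases lt_or_ge ‖y‖ 1 with h | h
    · simp [h0 y h]
    · rw [norm_smul, norm_mul, norm_mul, norm_pow, norm_inv, norm_norm, mul_assoc]
      gcongr
      have hy : 0 < ‖y‖ := by linarith
      calc ‖y‖⁻¹ ^ 3 * ‖y‖ = ‖y‖⁻¹ * ‖y‖⁻¹ := by field_simp
        _ ≤ ‖y‖⁻¹ * 1 := by gcongr; exact inv_le_one_of_one_le₀ h
        _ = ‖y‖⁻¹ := mul_one _
  refine ⟨∫ y, f y * ‖y‖⁻¹, ∫ y, (f y * (‖y‖⁻¹) ^ 3) • y, fun x => ?_⟩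
  have h2 : Integrable fun y : E3 => inner ℝ x ((f y * (‖y‖⁻¹) ^ 3) • y) := h1.const_inner x
  have h3 : (fun y => f y * (‖y‖⁻¹ + (‖y‖⁻¹) ^ 3 * inner ℝ x y))
      = fun y => f y * ‖y‖⁻¹ + inner ℝ x ((f y * (‖y‖⁻¹) ^ 3) • y) := by
    ext y
    rw [inner_smul_right]
    ring
  rw [h3]
  exact ⟨hf.add h2, by rw [integral_add hf h2, integral_inner h1]⟩

lemma HasInvLaplacian.isFarDensity {u w : E3 → ℝ} (hu : HasInvLaplacian u) {R : ℝ} (hR : 1 < R)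
    (hwm : AEStronglyMeasurable w) (h0 : ∀ y, ‖y‖ < R → w y = 0) (hle : ∀ y, |w y| ≤ |u y|) :
    IsFarDensity w R where
  pos := by linarith
  aesm := hwm
  zero := h0
  integrable := by
    refine (hu.norm.const_mul (2 ^ 3)).mono' (hwm.mul (by fun_prop))
      (Eventually.of_forall fun y => ?_)
    rcases lt_or_ge ‖y‖ R with h | h
    · rw [h0 y h]
      simp only [zero_mul, norm_zero]
      positivity
    · have h1 : 1 < ‖y‖ := hR.trans_le h
      have h2 : ‖y‖⁻¹ ≤ 2 / (1 + ‖y‖) := by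
        rw [inv_eq_one_div, div_le_div_iff₀ (by positivity) (by positivity)]
        linarith
      rw [norm_mul, norm_div, norm_pow, norm_pow, norm_inv, norm_norm,
        Real.norm_of_nonneg (show 0 ≤ 1 + ‖y‖ by positivity), mul_div_left_comm, ← div_pow]
      gcongr
      exact hle y

/-- Near the origin, `Δ⁻¹ u` is the Coulomb potential of a compactly supported density plus the
potential of a far density plus an affine function. -/
lemma exists_local_representation {u : E3 → ℝ} (hu : ContDiff ℝ (⊤ : ℕ∞) u)
    (hi : HasInvLaplacian u) {R : ℝ} (hR : 1 < R) :
    ∃ (f w : E3 → ℝ) (a : ℝ) (b : E3), ContDiff ℝ (⊤ : ℕ∞) f ∧ HasCompactSupport f ∧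
      IsFarDensity w R ∧ (∀ y, u y = f y + w y) ∧
      ∀ x, ‖x‖ < R / 2 → invLaplacian u x
        = -(1 / (4 * Real.pi)) * (coulomb f x + farPotential w x + (a + inner ℝ x b)) := by
  let χ : ContDiffBump (0 : E3) := ⟨R, R + 1, by linarith, by linarith⟩
  set f : E3 → ℝ := fun y => χ y * u y with hfdef
  set w : E3 → ℝ := fun y => (1 - χ y) * u y with hwdef
  have hf : ContDiff ℝ (⊤ : ℕ∞) f := χ.contDiff.mul hu
  have hs : HasCompactSupport f := χ.hasCompactSupport.mul_right
  have hwc : Continuous w := (continuous_const.sub χ.continuous).mul hu.continuous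
  have hw0 : ∀ y, ‖y‖ < R → w y = 0 := fun y hy => by
    have : χ y = 1 := χ.one_of_mem_closedBall (by simpa using hy.le)
    simp [hwdef, this]
  have hwu : ∀ y, |w y| ≤ |u y| := fun y => by
    have h1 := χ.nonneg (x := y)
    have h2 := χ.le_one (x := y)
    rw [hwdef, abs_mul]
    exact mul_le_of_le_one_left (abs_nonneg _) (abs_le.2 ⟨by linarith, by linarith⟩)
  have hw := hi.isFarDensity hR hwc.aestronglyMeasurable hw0 hwu
  have huf : ∀ y, u y = f y + w y := fun y => by simp only [hfdef, hwdef]; ring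
  have hif := integrable_mul_norm_sub_inv hf.continuous hs
  by_cases hN : Integrable fun y : E3 => u y / (1 + ‖y‖)
  -- Newtonian case: the Taylor part of the kernel, subtracted in `farPotential w`, is added back.
  -- Its integral against `w` converges because `u / (1 + |y|)` is integrable.
  · obtain ⟨a, b, hab⟩ := exists_affine hwc.aestronglyMeasurable
      (fun y hy => hw0 y (hy.trans hR)) (by
        refine (hN.norm.const_mul 2).mono' (hwc.aestronglyMeasurable.mul (by fun_prop))
          (Eventually.of_forall fun y => ?_)
        rcases lt_or_ge ‖y‖ R with h | h
        · rw [hw0 y h]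
          simp only [zero_mul, norm_zero]
          positivity
        · have h1 : 1 < ‖y‖ := hR.trans_le h
          have h2 : ‖y‖⁻¹ ≤ 2 / (1 + ‖y‖) := by
            rw [inv_eq_one_div, div_le_div_iff₀ (by positivity) (by positivity)]
            linarith
          rw [norm_mul, norm_div, norm_inv, norm_norm,
            Real.norm_of_nonneg (show 0 ≤ 1 + ‖y‖ by positivity), mul_div_left_comm]
          gcongr
          exact hwu y)
    refine ⟨f, w, a, b, hf, hs, hw, huf, fun x hx => ?_⟩
    rw [invLaplacian, if_pos hN, newtonPotential, coulomb_eq, farPotential, ← (hab x).2,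
      ← integral_add (hif x) (hw.integrable_farKernel hx), ← integral_add _ (hab x).1]
    · congr 2 with y
      rw [huf y, farKernel]
      ring
    · exact (hif x).add (hw.integrable_farKernel hx)
  -- Normalized case: on the support of `w` one has `|y| ≥ R > 1`, so the kernel is already
  -- `farKernel` there. The affine correction comes only from `f`, which lost its Taylor part on
  -- `|y| > 1`.
  · set g : E3 → ℝ := fun y => if 1 < ‖y‖ then -f y else 0 with hgdef
    have hgm : AEStronglyMeasurable g :=
      (Measurable.ite (measurableSet_lt measurable_const measurable_norm)
        hf.continuous.neg.measurable measurable_const).aestronglyMeasurable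
    obtain ⟨a, b, hab⟩ := exists_affine hgm (fun y hy => if_neg hy.not_gt) (by
        refine (hf.continuous.integrable_of_hasCompactSupport hs).norm.mono'
          (hgm.mul (by fun_prop)) (Eventually.of_forall fun y => ?_)
        by_cases h : 1 < ‖y‖
        · simp only [hgdef, if_pos h]
          rw [norm_mul, norm_neg, norm_inv, norm_norm]
          exact mul_le_of_le_one_right (norm_nonneg _) (inv_le_one_of_one_le₀ h.le)
        · simp [hgdef, if_neg h])
    refine ⟨f, w, a, b, hf, hs, hw, huf, fun x hx => ?_⟩
    rw [invLaplacian, if_neg hN, normalizedNewtonPotential, coulomb_eq, farPotential, ← (hab x).2,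
      ← integral_add (hif x) (hw.integrable_farKernel hx), ← integral_add _ (hab x).1]
    · congr 2 with y
      by_cases h : 1 < ‖y‖
      · simp only [hgdef, if_pos h]
        rw [huf y, farKernel]
        ring
      · simp only [hgdef, if_neg h]
        rw [huf y, hw0 y (by linarith)]
        ring
    · exact (hif x).add (hw.integrable_farKernel hx)

lemma pd_congr {f g : E3 → ℝ} {x : E3} (h : f =ᶠ[𝓝 x] g) (i : Fin 3) :
    pd i f =ᶠ[𝓝 x] pd i g := by
  filter_upwards [h.eventuallyEq_nhds] with y hy
  unfold pd
  rw [hy.fderiv_eq]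

lemma pd_add {f g : E3 → ℝ} {x : E3} (hf : DifferentiableAt ℝ f x) (hg : DifferentiableAt ℝ g x)
    (i : Fin 3) : pd i (fun x => f x + g x) x = pd i f x + pd i g x := by
  unfold pd
  rw [fderiv_fun_add hf hg]
  rfl

lemma pd_const_mul {f : E3 → ℝ} {x : E3} (hf : DifferentiableAt ℝ f x) (c : ℝ)
    (i : Fin 3) : pd i (fun x => c * f x) x = c * pd i f x := by
  unfold pd
  rw [fderiv_const_mul hf]
  rfl

lemma pd_affine (a : ℝ) (b x : E3) (i : Fin 3) :
    pd i (fun x => a + inner ℝ x b) x = b i := by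
  have h : HasFDerivAt (fun x : E3 => a + inner ℝ x b) (innerSL ℝ b) x := by
    refine HasFDerivAt.const_add a ((innerSL ℝ b).hasFDerivAt.congr_of_eventuallyEq
      (Eventually.of_forall fun z => ?_))
    simp [real_inner_comm]
  unfold pd
  rw [h.fderiv]
  exact inner_single_right b i

section

variable {u f w : E3 → ℝ} {R a : ℝ} {b x : E3}

lemma eventually_norm_lt_of_lt {x : E3} {s : ℝ} (h : ‖x‖ < s) : ∀ᶠ y in 𝓝 x, ‖y‖ < s :=
  continuous_norm.continuousAt.eventually_lt_const h

lemma IsFarDensity.contDiffAt_farPotential (hw : IsFarDensity w R) (hx : ‖x‖ < R / 2) :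
    ContDiffAt ℝ (⊤ : ℕ∞) (farPotential w) x :=
  hw.contDiffOn_farPotential.contDiffAt (Metric.isOpen_ball.mem_nhds (by simpa using hx))

lemma contDiff_affine (a : ℝ) (b : E3) : ContDiff ℝ (⊤ : ℕ∞) fun x : E3 => a + inner ℝ x b :=
  contDiff_const.add (contDiff_id.inner ℝ contDiff_const)

lemma pd_representation (hf : ContDiff ℝ (⊤ : ℕ∞) f) (hs : HasCompactSupport f)
    (hw : IsFarDensity w R) (hrep : ∀ x, ‖x‖ < R / 2 → u x
        = -(1 / (4 * Real.pi)) * (coulomb f x + farPotential w x + (a + inner ℝ x b)))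
    (hx : ‖x‖ < R / 2) (i : Fin 3) :
    pd i u x = -(1 / (4 * Real.pi)) * (pd i (coulomb f) x + pd i (farPotential w) x + b i) := by
  have h1 := ((contDiff_coulomb hf hs).differentiable (by simp)) x
  have h2 := (hw.contDiffAt_farPotential hx).differentiableAt (by simp)
  have h3 := ((contDiff_affine a b).differentiable (by simp)) x
  rw [(pd_congr ((eventually_norm_lt_of_lt hx).mono hrep) i).eq_of_nhds,
    pd_const_mul ((h1.fun_add h2).fun_add h3), pd_add (h1.fun_add h2) h3, pd_add h1 h2, pd_affine]

end

/-! ### Smoothness, Laplacian and gradient differences of `Δ⁻¹ u`. -/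

section

variable {u : E3 → ℝ}

lemma contDiff_invLaplacian (hu : ContDiff ℝ (⊤ : ℕ∞) u) (hi : HasInvLaplacian u) :
    ContDiff ℝ (⊤ : ℕ∞) (invLaplacian u) := by
  refine contDiff_iff_contDiffAt.2 fun x => ?_
  -- This radius exceeds 1 and puts `x` inside the ball of radius `R / 2`.
  obtain ⟨f, w, a, b, hf, hs, hw, -, hrep⟩ := exists_local_representation hu hi
    (R := 2 * (‖x‖ + 1)) (by have := norm_nonneg x; linarith)
  have hx : ‖x‖ < 2 * (‖x‖ + 1) / 2 := by linarith
  refine ContDiffAt.congr_of_eventuallyEq ?_ ((eventually_norm_lt_of_lt hx).mono hrep)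
  exact contDiffAt_const.mul (((contDiff_coulomb hf hs).contDiffAt.add
    (hw.contDiffAt_farPotential hx)).add (contDiff_affine a b).contDiffAt)

lemma sum_riesz (hu : ContDiff ℝ (⊤ : ℕ∞) u) (hi : HasInvLaplacian u) (x : E3) :
    ∑ i, riesz i i u x = u x := by
  obtain ⟨f, w, a, b, hf, hs, hw, huf, hrep⟩ := exists_local_representation hu hi
    (R := 2 * (‖x‖ + 1)) (by have := norm_nonneg x; linarith)
  have hx : ‖x‖ < 2 * (‖x‖ + 1) / 2 := by linarith
  have h : ∀ i, riesz i i u x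
      = -(1 / (4 * Real.pi)) * (pd i (pd i (coulomb f)) x + pd i (pd i (farPotential w)) x) := by
    intro i
    have h1 := ((contDiff_pd (contDiff_coulomb hf hs) i).differentiable (by simp)) x
    have h2 : DifferentiableAt ℝ (pd i (farPotential w)) x :=
      (((hw.contDiffAt_farPotential hx).fderiv_right (m := 1) (by norm_cast)).clm_apply
        contDiffAt_const).differentiableAt one_ne_zero
    have h3 : DifferentiableAt ℝ (fun _ : E3 => b i) x := differentiableAt_const _
    have h4 : pd i (fun _ : E3 => b i) x = 0 := by simp [pd]
    rw [riesz, (pd_congr ((eventually_norm_lt_of_lt hx).mono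
      fun y hy => pd_representation hf hs hw hrep hy i) i).eq_of_nhds,
      pd_const_mul ((h1.fun_add h2).fun_add h3), pd_add (h1.fun_add h2) h3, pd_add h1 h2, h4,
      add_zero]
  -- Hence `u x = f x`, and the compactly supported part alone produces the Laplacian.
  have hwx : w x = 0 := hw.zero x (by have := norm_nonneg x; linarith)
  rw [Finset.sum_congr rfl fun i _ => h i, ← Finset.mul_sum, Finset.sum_add_distrib,
    sum_pd_pd_coulomb hf hs, hw.sum_pd_pd_farPotential hx, huf x, hwx]
  have := Real.pi_pos
  field_simp
  ring

/-- The Coulomb field `z_i / |z|³`. -/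
def field (i : Fin 3) (z : E3) : ℝ := (‖z‖⁻¹) ^ 3 * z i

/-- Differences of first derivatives of `Δ⁻¹ u` do not see the normalization of the kernel. -/
lemma pd_invLaplacian_sub (hu : ContDiff ℝ (⊤ : ℕ∞) u) (hi : HasInvLaplacian u) (i : Fin 3)
    (x x' : E3) :
    pd i (invLaplacian u) x - pd i (invLaplacian u) x'
        = 1 / (4 * Real.pi) * ∫ y, u y * (field i (x - y) - field i (x' - y)) := by
  set R := 2 * (‖x‖ + ‖x'‖ + 1) with hR
  have hn := norm_nonneg x
  have hn' := norm_nonneg x'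
  obtain ⟨f, w, a, b, hf, hs, hw, huf, hrep⟩ := exists_local_representation hu hi
    (R := R) (by linarith)
  have hx : ‖x‖ < R / 2 := by linarith
  have hx' : ‖x'‖ < R / 2 := by linarith
  -- The term `|y|⁻³ y_i` left by the Taylor polynomial does not depend on `z`, so it cancels in the
  -- difference.
  have hfar : ∀ z, ‖z‖ < R / 2 → ∀ y, w y * farKernel' z y (EuclideanSpace.single i 1)
      = -(w y * (field i (z - y) + (‖y‖⁻¹) ^ 3 * y i)) := by
    intro z hz y
    rcases lt_or_ge ‖y‖ R with h | h
    · simp [hw.zero y h]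
    · rw [farKernel', fderiv_regKernel_zero (sub_ne_zero_of_far hw.pos hz h)]
      simp only [sub_apply, smul_apply,
        innerSL_apply_apply, inner_single_right, smul_eq_mul, field]
      ring
  have hint : ∀ z, ‖z‖ < R / 2 →
      Integrable fun y => w y * farKernel' z y (EuclideanSpace.single i 1) := fun z hz =>
    (hw.integrable_farKernel' hz).apply_continuousLinearMap (EuclideanSpace.single i 1)
  have hfld : ∀ z, Integrable fun y => field i (z - y) * f y := fun z =>
    integrable_kernel_mul hf.continuous hs z i
  rw [pd_representation hf hs hw hrep hx, pd_representation hf hs hw hrep hx',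
    hw.pd_farPotential hx, hw.pd_farPotential hx',
    pd_coulomb_apply (hf.of_le (by simp)) hs, pd_coulomb_apply (hf.of_le (by simp)) hs]
  have key : ∫ y, u y * (field i (x - y) - field i (x' - y))
      = (∫ y, field i (x - y) * f y) - (∫ y, field i (x' - y) * f y)
        - ((∫ y, w y * farKernel' x y (EuclideanSpace.single i 1))
          - ∫ y, w y * farKernel' x' y (EuclideanSpace.single i 1)) := by
    have h1 : Integrable fun y => field i (x - y) * f y - field i (x' - y) * f y :=
      (hfld x).sub (hfld x')
    have h2 : Integrable fun y => w y * farKernel' x y (EuclideanSpace.single i 1)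
        - w y * farKernel' x' y (EuclideanSpace.single i 1) := (hint x hx).sub (hint x' hx')
    rw [← integral_sub (hfld x) (hfld x'), ← integral_sub (hint x hx) (hint x' hx'),
      ← integral_sub h1 h2]
    congr 1 with y
    rw [hfar x hx, hfar x' hx', huf y]
    ring
  rw [key]
  unfold field
  ring

end

/-! ### Axisymmetry of the inverse Laplacian. -/

section Isometry

variable {u : E3 → ℝ}

/-- Both kernels involve only `|x - y|`, `|y|` and `x · y`, which a linear isometry preserves
together with Lebesgue measure. -/
lemma invLaplacian_comp_isometry (σ : E3 ≃ₗᵢ[ℝ] E3) (hσ : ∀ y, u (σ y) = u y) (x : E3) :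
    invLaplacian u (σ x) = invLaplacian u x := by
  have hc : ∀ g : E3 → ℝ, ∫ y, g (σ y) = ∫ y, g y := fun g =>
    σ.measurePreserving.integral_comp σ.toHomeomorph.measurableEmbedding g
  unfold invLaplacian
  split_ifs
  · unfold newtonPotential
    rw [← hc]
    simp only [hσ, ← map_sub, LinearIsometryEquiv.norm_map]
  · unfold normalizedNewtonPotential
    rw [← hc]
    simp only [hσ, ← map_sub, LinearIsometryEquiv.norm_map, LinearIsometryEquiv.inner_map_map]

lemma r_sq (x : E3) : r x ^ 2 = x 0 ^ 2 + x 1 ^ 2 := Real.sq_sqrt (by positivity)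

lemma r_eq_sqrt (x : E3) : r x = Real.sqrt (‖x‖ ^ 2 - x 2 ^ 2) := by
  rw [norm_sq_eq_sum, Fin.sum_univ_three, add_sub_cancel_right, r]

lemma IsAxisymmetric.comp_isometry (hu : IsAxisymmetric u) (σ : E3 ≃ₗᵢ[ℝ] E3)
    (hσ : σ (EuclideanSpace.single 2 1) = EuclideanSpace.single 2 1) (y : E3) :
    u (σ y) = u y := by
  have h2 : (σ y) 2 = y 2 := by
    rw [← inner_single_right (σ y), ← hσ, LinearIsometryEquiv.inner_map_map, inner_single_right]
  refine hu _ _ ?_ h2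
  rw [r_eq_sqrt, r_eq_sqrt, LinearIsometryEquiv.norm_map, h2]

/-- Two points with equal `r` and `x₃` have equal norm, so the reflection in the hyperplane
orthogonal to `x - y` exchanges them. It fixes the vertical axis because `x - y` is horizontal. -/
lemma isAxisymmetric_invLaplacian (hu : IsAxisymmetric u) : IsAxisymmetric (invLaplacian u) := by
  intro x y hr h2
  have hn : ‖x‖ = ‖y‖ := by
    have h : ‖x‖ ^ 2 = ‖y‖ ^ 2 := by
      rw [norm_sq_eq_sum, norm_sq_eq_sum, Fin.sum_univ_three, Fin.sum_univ_three, ← r_sq, ← r_sq,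
        hr, h2]
    exact (pow_left_inj₀ (norm_nonneg _) (norm_nonneg _) two_ne_zero).1 h
  have h := Submodule.reflection_sub hn
  rw [← h]
  refine (invLaplacian_comp_isometry _ (hu.comp_isometry _ ?_) x).symm
  refine Submodule.reflection_mem_subspace_eq_self ?_
  rw [Submodule.mem_orthogonal_singleton_iff_inner_right, inner_single_right]
  simp [h2]

end Isometry

/-! ### Differential identities for axisymmetric functions. -/

section Angular

variable {v : E3 → ℝ}

lemma fderiv_apply_combo (x : E3) (a b : ℝ) :
    fderiv ℝ v x (a • EuclideanSpace.single 0 1 + b • EuclideanSpace.single 1 1)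
      = a * pd 0 v x + b * pd 1 v x := by
  simp [pd]

/-- The angular derivative of an axisymmetric function vanishes. -/
lemma IsAxisymmetric.angular (hv : IsAxisymmetric v) {x : E3} (hd : DifferentiableAt ℝ v x) :
    x 0 * pd 1 v x - x 1 * pd 0 v x = 0 := by
  set e0 : E3 := EuclideanSpace.single 0 1
  set e1 : E3 := EuclideanSpace.single 1 1
  -- The rotation of `x` by the angle `t` about the vertical axis.
  let γ : ℝ → E3 := fun t =>
    x + (Real.cos t - 1) • (x 0 • e0 + x 1 • e1) + Real.sin t • ((-x 1) • e0 + x 0 • e1)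
  have hγ0 : γ 0 = x := by simp [γ]
  have hγ : HasDerivAt γ ((-x 1) • e0 + x 0 • e1) 0 := by
    have h1 := ((Real.hasDerivAt_cos 0).sub_const 1).smul_const (x 0 • e0 + x 1 • e1)
    have h2 := (Real.hasDerivAt_sin 0).smul_const ((-x 1) • e0 + x 0 • e1)
    refine ((h1.const_add x).add h2).congr_deriv ?_
    simp
  have hc : v ∘ γ = fun _ => v x := by
    ext t
    refine hv _ _ ?_ ?_
    · unfold r
      congr 1
      simp only [γ, e0, e1, PiLp.add_apply, PiLp.smul_apply, PiLp.single_apply]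
      simp
      linear_combination (x 0 ^ 2 + x 1 ^ 2) * Real.sin_sq_add_cos_sq t
    · simp [γ, e0, e1]
  have h := HasFDerivAt.comp_hasDerivAt (f := γ) (0 : ℝ) (hγ0.symm ▸ hd.hasFDerivAt) hγ
  rw [hc] at h
  have h3 := h.unique (hasDerivAt_const (0 : ℝ) (v x))
  rw [hγ0, fderiv_apply_combo] at h3
  linarith

lemma pd_comm (hv : ContDiff ℝ (⊤ : ℕ∞) v) (i j : Fin 3) (x : E3) :
    pd i (pd j v) x = pd j (pd i v) x := by
  have hd : DifferentiableAt ℝ (fderiv ℝ v) x :=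
    ((hv.fderiv_right (m := 1) (by norm_cast)).differentiable one_ne_zero) x
  have h : ∀ i j, pd i (pd j v) x
      = fderiv ℝ (fderiv ℝ v) x (EuclideanSpace.single i 1) (EuclideanSpace.single j 1) := by
    intro i j
    have h1 := hd.hasFDerivAt.clm_apply
      (hasFDerivAt_const (EuclideanSpace.single j (1 : ℝ) : E3) x)
    have : pd i (pd j v) x = fderiv ℝ (fun z => fderiv ℝ v z
      (EuclideanSpace.single j 1)) x (EuclideanSpace.single i 1) := rfl
    rw [this, h1.fderiv]
    simp
  rw [h, h]
  exact (hv.contDiffAt.isSymmSndFDerivAt (by simp; norm_cast)) _ _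

lemma hasFDerivAt_coord (i : Fin 3) (x : E3) :
    HasFDerivAt (fun y : E3 => y i) (EuclideanSpace.proj i : E3 →L[ℝ] ℝ) x :=
  (EuclideanSpace.proj i : E3 →L[ℝ] ℝ).hasFDerivAt

/-- In terms of second derivatives, `r ∂_r v = (x₂² ∂₁₁ + x₁² ∂₂₂ - 2 x₁ x₂ ∂₁₂) v` for
axisymmetric `v`. -/
lemma IsAxisymmetric.radial (hv : IsAxisymmetric v) (hs : ContDiff ℝ (⊤ : ℕ∞) v) (x : E3) :
    x 0 * pd 0 v x + x 1 * pd 1 v x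
      = x 1 ^ 2 * pd 0 (pd 0 v) x + x 0 ^ 2 * pd 1 (pd 1 v) x
        - 2 * (x 0 * x 1) * pd 0 (pd 1 v) x := by
  -- The vanishing angular derivative is differentiated in the directions `x₁` and `x₂`; `x₂` times
  -- the first relation minus `x₁` times the second is the claim.
  have h0 : (fun y : E3 => y 0 * pd 1 v y - y 1 * pd 0 v y) = fun _ => 0 :=
    funext fun y => hv.angular (hs.differentiable (by simp) y)
  have hd : ∀ i, HasFDerivAt (pd i v) (fderiv ℝ (pd i v) x) x := fun i =>
    ((contDiff_pd hs i).differentiable (by simp) x).hasFDerivAt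
  have h1 := ((hasFDerivAt_coord 0 x).mul (hd 1)).sub ((hasFDerivAt_coord 1 x).mul (hd 0))
  have h2 := (HasFDerivAt.congr_of_eventuallyEq h1
    (Eventually.of_forall fun y => (congrFun h0 y).symm)).unique (hasFDerivAt_const (0 : ℝ) x)
  have h3 := congrArg (fun L => L (EuclideanSpace.single 0 1)) h2
  have h4 := congrArg (fun L => L (EuclideanSpace.single 1 1)) h2
  have hp : ∀ i j, fderiv ℝ (pd i v) x (EuclideanSpace.single j 1) = pd j (pd i v) x :=
    fun _ _ => rfl
  simp [hp] at h3 h4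
  rw [pd_comm hs 1 0] at h4
  linear_combination x 1 * h3 - x 0 * h4

lemma IsAxisymmetric.drOverR_eq (hv : IsAxisymmetric v) (hs : ContDiff ℝ (⊤ : ℕ∞) v) {x : E3}
    (hr : r x ≠ 0) :
    drOverR v x = x 1 ^ 2 / r x ^ 2 * pd 0 (pd 0 v) x + x 0 ^ 2 / r x ^ 2 * pd 1 (pd 1 v) x
        - 2 * (x 0 * x 1 / r x ^ 2) * pd 0 (pd 1 v) x := by
  have h := hv.radial hs x
  unfold drOverR
  field_simp
  linear_combination h

/-- Off the plane `x₁ = 0`, `∂_r v / r = ∂₁ v / x₁` for axisymmetric `v`. -/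
lemma IsAxisymmetric.drOverR_eq_div (hv : IsAxisymmetric v) (hs : ContDiff ℝ (⊤ : ℕ∞) v) {x : E3}
    (hx : x 0 ≠ 0) : drOverR v x = pd 0 v x / x 0 := by
  have h := hv.angular (hs.differentiable (by simp) x)
  have h2 := r_sq x
  have hr : r x ≠ 0 := by
    intro h3
    rw [h3] at h2
    have : 0 < x 0 ^ 2 := by positivity
    nlinarith [sq_nonneg (x 1)]
  unfold drOverR
  field_simp
  rw [h2]
  linear_combination x 1 * h

end Angular

/-! ### Oddness under a reflection. -/

section Flip

/-- The reflection `x₁ ↦ -x₁`. -/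
def flip : E3 ≃ₗᵢ[ℝ] E3 := (ℝ ∙ (EuclideanSpace.single 0 1 : E3))ᗮ.reflection

lemma flip_single_zero :
    flip (EuclideanSpace.single 0 1) = -(EuclideanSpace.single 0 1 : E3) :=
  Submodule.reflection_orthogonalComplement_singleton_eq_neg _

lemma flip_single {i : Fin 3} (hi : i ≠ 0) :
    flip (EuclideanSpace.single i 1) = (EuclideanSpace.single i 1 : E3) := by
  refine Submodule.reflection_mem_subspace_eq_self ?_
  rw [Submodule.mem_orthogonal_singleton_iff_inner_right, inner_single_right]
  simp [hi]

lemma flip_apply_zero (x : E3) : flip x 0 = -x 0 := by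
  rw [← inner_single_right (flip x), ← neg_neg (EuclideanSpace.single 0 1 : E3),
    ← flip_single_zero, inner_neg_right, LinearIsometryEquiv.inner_map_map, inner_single_right]

lemma flip_apply {i : Fin 3} (hi : i ≠ 0) (x : E3) : flip x i = x i := by
  rw [← inner_single_right (flip x), ← flip_single hi, LinearIsometryEquiv.inner_map_map,
    inner_single_right]

lemma norm_sub_flip (x : E3) : ‖x - flip x‖ = 2 * |x 0| := by
  have h : ‖x - flip x‖ ^ 2 = (2 * |x 0|) ^ 2 := by
    rw [norm_sq_eq_sum, Fin.sum_univ_three]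
    simp only [PiLp.sub_apply]
    rw [flip_apply_zero, flip_apply (by decide), flip_apply (by decide), mul_pow, sq_abs]
    ring
  exact (pow_left_inj₀ (norm_nonneg _) (by positivity) two_ne_zero).1 h

lemma IsAxisymmetric.pd_flip {v : E3 → ℝ} (hv : IsAxisymmetric v)
    (hs : ContDiff ℝ (⊤ : ℕ∞) v) (x : E3) : pd 0 v (flip x) = - pd 0 v x := by
  have hc : (fun y => v (flip y)) = v := funext (hv.comp_isometry flip (flip_single (by decide)))
  have h1 := (hs.differentiable (by simp) (flip x)).hasFDerivAt
  have h2 : HasFDerivAt (fun y => v (flip y)) _ x :=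
    h1.comp x (flip.toContinuousLinearEquiv.toContinuousLinearMap.hasFDerivAt)
  rw [hc] at h2
  unfold pd
  conv_rhs => rw [h2.fderiv]
  have h3 : (flip.toContinuousLinearEquiv : E3 →L[ℝ] E3) (EuclideanSpace.single 0 1)
    = -(EuclideanSpace.single 0 1 : E3) := flip_single_zero
  rw [ContinuousLinearMap.comp_apply, h3, map_neg, neg_neg]

end Flip

/-! ### Domination by a positive kernel. -/

section Kernel

/-- The positive kernel which dominates `∂_r / r Δ⁻¹` on axisymmetric functions. -/
def domKernel (x y : E3) : ℝ := (‖x - y‖⁻¹) ^ 2 * (max ‖x - y‖ (max |x 0| |y 0|))⁻¹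

lemma domKernel_comm (x y : E3) : domKernel x y = domKernel y x := by
  rw [domKernel, domKernel, norm_sub_rev, max_comm |x 0|]

lemma domKernel_nonneg (x y : E3) : 0 ≤ domKernel x y := by
  unfold domKernel; positivity

lemma domKernel_flip (x y : E3) : domKernel (flip x) (flip y) = domKernel x y := by
  simp only [domKernel, ← map_sub, LinearIsometryEquiv.norm_map, flip_apply_zero, abs_neg]

/-- With `α = 1/|a| ≤ β = 1/|b|`, write `a₁α³ - b₁β³ = (a₁ - b₁)α³ + b₁(α³ - β³)` and factor `α - β
= (|b| - |a|)αβ` out of the last difference. Each of the four resulting terms is at most `|a - b| α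
β²`. -/
lemma abs_field_sub_le_of_le {a b : E3} (hb : b ≠ 0) (hab : ‖b‖ ≤ ‖a‖) :
    |field 0 a - field 0 b| ≤ 4 * ‖a - b‖ * ((‖b‖⁻¹) ^ 2 * ‖a‖⁻¹) := by
  have hb' := norm_pos_iff.2 hb
  have ha' : 0 < ‖a‖ := hb'.trans_le hab
  have h1 : |a 0 - b 0| ≤ ‖a - b‖ := abs_apply_le_norm (a - b) 0
  have h2 : |‖b‖ - ‖a‖| ≤ ‖a - b‖ := by rw [norm_sub_rev]; exact abs_norm_sub_norm_le b a
  have h3 := abs_apply_le_norm b 0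
  have h4 : field 0 a - field 0 b = (a 0 - b 0) * (‖a‖⁻¹) ^ 3
      + b 0 * ((‖b‖ - ‖a‖) * (((‖a‖⁻¹) * ‖b‖⁻¹ ^ 3) + (‖a‖⁻¹) ^ 2 * ‖b‖⁻¹ ^ 2
        + (‖a‖⁻¹) ^ 3 * ‖b‖⁻¹)) := by
    unfold field
    field_simp
    ring
  have hinv : ‖a‖⁻¹ ≤ ‖b‖⁻¹ := inv_anti₀ hb' hab
  set α := ‖a‖⁻¹
  set β := ‖b‖⁻¹
  have hα : 0 < α := inv_pos.2 ha'
  have hβ : 0 < β := inv_pos.2 hb'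
  have hβb : ‖b‖ * β = 1 := mul_inv_cancel₀ hb'.ne'
  rw [h4]
  calc |(a 0 - b 0) * α ^ 3 + b 0 * ((‖b‖ - ‖a‖) * (α * β ^ 3 + α ^ 2 * β ^ 2 + α ^ 3 * β))|
      ≤ |a 0 - b 0| * α ^ 3
        + |b 0| * (|‖b‖ - ‖a‖| * (α * β ^ 3 + α ^ 2 * β ^ 2 + α ^ 3 * β)) := by
        refine (abs_add_le _ _).trans (le_of_eq ?_)
        rw [abs_mul, abs_mul, abs_mul, abs_of_pos (pow_pos hα 3),
          abs_of_pos (show 0 < α * β ^ 3 + α ^ 2 * β ^ 2 + α ^ 3 * β by positivity)]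
    _ ≤ ‖a - b‖ * (α * β ^ 2)
        + ‖b‖ * (‖a - b‖ * (α * β ^ 3 + α * β * β ^ 2 + α * β ^ 2 * β)) := by
        gcongr
        · calc α ^ 3 = α * α ^ 2 := by ring
            _ ≤ α * β ^ 2 := by gcongr
        · calc α ^ 2 = α * α := by ring
            _ ≤ α * β := by gcongr
        · calc α ^ 3 = α * α ^ 2 := by ring
            _ ≤ α * β ^ 2 := by gcongr
    _ = 4 * ‖a - b‖ * (β ^ 2 * α) := by
        linear_combination (3 * ‖a - b‖ * α * β ^ 2) * hβb

/-- The points `x` and `flip x` are `2|x₁|` apart. By the triangle inequality the larger of their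
distances to `y` dominates both `|x₁|` and `|y₁|`, so it dominates the maximum in `domKernel` taken
at the nearer point. -/
lemma abs_field_sub_le {x y : E3} (h : x - y ≠ 0) (h' : flip x - y ≠ 0) :
    |field 0 (x - y) - field 0 (flip x - y)|
      ≤ 8 * |x 0| * (domKernel x y + domKernel (flip x) y) := by
  have hd : ‖(x - y) - (flip x - y)‖ = 2 * |x 0| := by
    rw [sub_sub_sub_cancel_right, norm_sub_flip]
  have hx1 := norm_sub_le (x - y) (flip x - y)
  rw [hd] at hx1
  have h1 := abs_apply_le_norm (x - y) 0
  have h2 := abs_apply_le_norm (flip x - y) 0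
  simp only [PiLp.sub_apply, flip_apply_zero] at h1 h2
  have hy1 : 2 * |y 0| ≤ ‖x - y‖ + ‖flip x - y‖ := by
    have h3 : 2 * |y 0| ≤ |x 0 - y 0| + |-x 0 - y 0| := by
      rw [show 2 * |y 0| = |(x 0 - y 0) + (-x 0 - y 0)| by
        rw [show x 0 - y 0 + (-x 0 - y 0) = -(2 * y 0) by ring, abs_neg, abs_mul, abs_two]]
      exact abs_add_le _ _
    linarith
  have hp := norm_pos_iff.2 h
  have hp' := norm_pos_iff.2 h'
  have hk := domKernel_nonneg x y
  have hk' := domKernel_nonneg (flip x) y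
  rcases le_total ‖flip x - y‖ ‖x - y‖ with hle | hle
  · have := abs_field_sub_le_of_le h' hle
    rw [hd] at this
    calc _ ≤ _ := this
      _ = 8 * |x 0| * ((‖flip x - y‖⁻¹) ^ 2 * ‖x - y‖⁻¹) := by ring
      _ ≤ 8 * |x 0| * domKernel (flip x) y := by
        unfold domKernel
        gcongr
        rw [flip_apply_zero, abs_neg]
        exact max_le hle (max_le (by linarith) (by linarith))
      _ ≤ _ := by gcongr; linarith
  · have := abs_field_sub_le_of_le h hle
    rw [norm_sub_rev, hd, abs_sub_comm] at this
    calc _ ≤ _ := this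
      _ = 8 * |x 0| * ((‖x - y‖⁻¹) ^ 2 * ‖flip x - y‖⁻¹) := by ring
      _ ≤ 8 * |x 0| * domKernel x y := by
        unfold domKernel
        gcongr
        exact max_le hle (max_le (by linarith) (by linarith))
      _ ≤ _ := by gcongr; linarith

lemma measurable_domKernel : Measurable (Function.uncurry domKernel) := by
  unfold domKernel Function.uncurry
  fun_prop

/-- The positive integral operator with kernel `domKernel`. -/
def domOp (g : E3 → ENNReal) (x : E3) : ENNReal := ∫⁻ y, ENNReal.ofReal (domKernel x y) * g y

lemma domOp_flip {g : E3 → ENNReal} (hg : ∀ y, g (flip y) = g y) (x : E3) :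
    domOp g (flip x) = domOp g x := by
  unfold domOp
  rw [← flip.measurePreserving.lintegral_comp_emb flip.toHomeomorph.measurableEmbedding]
  simp only [hg, domKernel_flip]

/-- The pointwise domination of `∂_r / r Δ⁻¹ u` by a positive operator. -/
lemma enorm_drOverR_invLaplacian_le {u : E3 → ℝ} (hu : ContDiff ℝ (⊤ : ℕ∞) u)
    (ha : IsAxisymmetric u) (hi : HasInvLaplacian u) {x : E3} (hx : x 0 ≠ 0) :
    ‖drOverR (invLaplacian u) x‖ₑ ≤ domOp (fun y => ‖u y‖ₑ) x := by
  have hv := isAxisymmetric_invLaplacian ha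
  have hs := contDiff_invLaplacian hu hi
  have h1 := pd_invLaplacian_sub hu hi 0 x (flip x)
  rw [hv.pd_flip hs] at h1
  -- Oddness makes the difference in `h1` equal to `2 ∂₁ v(x)`, whence `8π` in place of `4π`.
  have h2 : drOverR (invLaplacian u) x
      = 1 / (8 * Real.pi * x 0) * ∫ y, u y * (field 0 (x - y) - field 0 (flip x - y)) := by
    rw [hv.drOverR_eq_div hs hx]
    have := Real.pi_pos
    field_simp at h1 ⊢
    linarith
  have hflip : ∀ y, u (flip y) = u y := ha.comp_isometry flip (flip_single (by decide))
  have hne : ∀ z : E3, ∀ᵐ y : E3, z - y ≠ 0 := fun z =>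
    (Measure.measurePreserving_sub_left volume z).quasiMeasurePreserving.ae ae_ne_zero
  have hmeas : ∀ z, Measurable fun y => ENNReal.ofReal (domKernel z y) := fun z =>
    (measurable_domKernel.comp measurable_prodMk_left).ennreal_ofReal
  have h3 : ∫⁻ y, ‖u y * (field 0 (x - y) - field 0 (flip x - y))‖ₑ
      ≤ ENNReal.ofReal (8 * |x 0|) * (ENNReal.ofReal 2 * domOp (fun y => ‖u y‖ₑ) x) := by
    calc _ ≤ ∫⁻ y, ENNReal.ofReal (8 * |x 0|) * (ENNReal.ofReal (domKernel x y) * ‖u y‖ₑ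
          + ENNReal.ofReal (domKernel (flip x) y) * ‖u y‖ₑ) := by
          refine lintegral_mono_ae ?_
          filter_upwards [hne x, hne (flip x)] with y hy hy'
          rw [enorm_mul, mul_comm, ← add_mul, ← mul_assoc]
          gcongr
          rw [← ENNReal.ofReal_add (domKernel_nonneg _ _) (domKernel_nonneg _ _),
            ← ENNReal.ofReal_mul (by positivity), ← ofReal_norm]
          exact ENNReal.ofReal_le_ofReal (abs_field_sub_le hy hy')
      _ = ENNReal.ofReal (8 * |x 0|) * (domOp (fun y => ‖u y‖ₑ) x
          + domOp (fun y => ‖u y‖ₑ) (flip x)) := by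
          rw [lintegral_const_mul', lintegral_add_left]
          · rfl
          · exact (hmeas x).mul hu.continuous.measurable.enorm
          · exact ENNReal.ofReal_ne_top
      _ = _ := by
          rw [domOp_flip (fun y => by rw [hflip]), ← two_mul, ENNReal.ofReal_ofNat]
  rw [h2, enorm_mul]
  calc _ ≤ ‖1 / (8 * Real.pi * x 0)‖ₑ *
        (ENNReal.ofReal (8 * |x 0|) * (ENNReal.ofReal 2 * domOp (fun y => ‖u y‖ₑ) x)) := by
        gcongr
        exact (enorm_integral_le_lintegral_enorm _).trans h3
    _ = ENNReal.ofReal (2 / Real.pi) * domOp (fun y => ‖u y‖ₑ) x := by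
        rw [← mul_assoc, ← mul_assoc]
        congr 1
        rw [← ofReal_norm, ← ENNReal.ofReal_mul (norm_nonneg _), ← ENNReal.ofReal_mul (by positivity)]
        congr 1
        rw [norm_div, norm_mul, norm_mul, Real.norm_of_nonneg Real.pi_pos.le, Real.norm_eq_abs (x 0)]
        have h5 := abs_pos.2 hx
        have := Real.pi_pos
        norm_num
        field_simp
    _ ≤ 1 * domOp (fun y => ‖u y‖ₑ) x := by
        gcongr
        rw [ENNReal.ofReal_le_one, div_le_one Real.pi_pos]
        linarith [Real.pi_gt_three]
    _ = _ := one_mul _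

end Kernel

/-! ### One-dimensional profiles. -/

section OneDim

/-- A one-dimensional profile with a singularity `|t|^{-c}` and decay `|t|^{-c-e}`. -/
def profile (c e s t : ℝ) : ℝ := |t| ^ (-c) * (max |t| s) ^ (-e)

lemma profile_nonneg {c e s t : ℝ} : 0 ≤ profile c e s t := by
  have : 0 ≤ max |t| s := (abs_nonneg t).trans (le_max_left _ _)
  unfold profile
  positivity

lemma measurable_profile (c e s : ℝ) : Measurable (profile c e s) := by
  unfold profile
  fun_prop

lemma integrable_profile_one {c e : ℝ} (hc : c < 1) (hce : 1 < c + e) :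
    Integrable (profile c e 1) := by
  rw [← integrableOn_univ, ← Set.union_compl_self (Metric.ball (0 : ℝ) 1)]
  refine IntegrableOn.union ?_ ?_
  · refine integrableOn_ball_of_norm_le_rpow (C := 1) (α := c) (by simp) (by simpa using hc) ?_
      (measurable_profile c e 1).aestronglyMeasurable
    filter_upwards [ae_restrict_mem measurableSet_ball] with t ht
    rw [mem_ball_zero_iff, Real.norm_eq_abs] at ht
    rw [Real.norm_of_nonneg profile_nonneg, profile, max_eq_right ht.le, Real.one_rpow, one_mul,
      mul_one, Real.norm_eq_abs]
  · have h := ((integrable_one_add_norm (E := ℝ) (μ := volume) (r := c + e)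
      (by simpa using hce)).const_mul (2 ^ (c + e))).integrableOn (s := (Metric.ball (0 : ℝ) 1)ᶜ)
    refine h.mono' (measurable_profile c e 1).aestronglyMeasurable ?_
    filter_upwards [ae_restrict_mem measurableSet_ball.compl] with t ht
    rw [Set.mem_compl_iff, mem_ball_zero_iff, not_lt, Real.norm_eq_abs] at ht
    have ht0 : 0 < |t| := by linarith
    rw [Real.norm_of_nonneg profile_nonneg, profile, max_eq_left ht, ← Real.rpow_add ht0,
      Real.norm_eq_abs, Real.rpow_neg (by positivity), ← div_eq_mul_inv,
      ← Real.div_rpow (by norm_num) (by positivity), ← neg_add, Real.rpow_neg ht0.le,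
      ← Real.inv_rpow ht0.le]
    refine Real.rpow_le_rpow (by positivity) ?_ (by linarith)
    rw [inv_eq_one_div, div_le_div_iff₀ (by positivity) (by positivity)]
    linarith

lemma profile_scale {c e s : ℝ} (hs : 0 < s) (t : ℝ) :
    profile c e s (s * t) = s ^ (-c - e) * profile c e 1 t := by
  unfold profile
  have h1 : max |s * t| s = s * max |t| 1 := by
    rw [abs_mul, abs_of_pos hs, mul_max_of_nonneg _ _ hs.le, mul_one]
  rw [h1, abs_mul, abs_of_pos hs, Real.mul_rpow hs.le (abs_nonneg _),
    Real.mul_rpow hs.le (by positivity), sub_eq_add_neg, Real.rpow_add hs]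
  ring

/-- Scaling `t ↦ s t` reduces to `s = 1`, where `c < 1` gives integrability at 0 and `c + e > 1` at
infinity. -/
lemma lintegral_profile {c e : ℝ} (hc : c < 1) (hce : 1 < c + e) :
    ∃ A : ℝ, 0 ≤ A ∧ ∀ s, 0 < s →
      ∫⁻ t, ENNReal.ofReal (profile c e s t) ≤ ENNReal.ofReal (A * s ^ (1 - c - e)) := by
  refine ⟨∫ t, profile c e 1 t, integral_nonneg fun _ => profile_nonneg, fun s hs => ?_⟩
  have h1 := integrable_profile_one hc hce
  have h2 : Integrable fun t => profile c e s (s * t) := by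
    simpa only [profile_scale hs] using h1.const_mul _
  have h3 : Integrable (profile c e s) := (integrable_comp_mul_left_iff _ hs.ne').1 h2
  rw [← ofReal_integral_eq_lintegral_ofReal h3 (Eventually.of_forall fun _ => profile_nonneg)]
  refine ENNReal.ofReal_le_ofReal (le_of_eq ?_)
  have h4 := Measure.integral_comp_mul_left (profile c e s) s
  simp only [profile_scale hs, integral_const_mul] at h4
  rw [abs_of_pos (inv_pos.2 hs), smul_eq_mul, eq_comm, inv_mul_eq_iff_eq_mul₀ hs.ne'] at h4
  have h5 : s ^ (1 - c - e) = s * s ^ (-c - e) := by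
    rw [show 1 - c - e = 1 + (-c - e) by ring, Real.rpow_add hs, Real.rpow_one]
  rw [h4, h5]
  ring

end OneDim

/-! ### Coordinate hyperplanes and product integrals. -/

section Product

lemma ae_apply_ne (i : Fin 3) (c : ℝ) : ∀ᵐ y : E3, y i ≠ c := by
  have h : ∀ᵐ y : Fin 3 → ℝ, y i ≠ c := by
    have := Measure.pi_hyperplane (fun _ : Fin 3 => (volume : Measure ℝ)) i c
    rw [ae_iff, volume_pi]
    simpa using this
  exact (PiLp.volume_preserving_ofLp (Fin 3)).quasiMeasurePreserving.ae h

lemma lintegral_fin_three {f g h : ℝ → ENNReal} (hf : Measurable f) (hg : Measurable g)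
    (hh : Measurable h) :
    ∫⁻ y : E3, f (y 0) * (g (y 1) * h (y 2)) = (∫⁻ t, f t) * ((∫⁻ t, g t) * ∫⁻ t, h t) := by
  have e1 : ∫⁻ z : Fin 2 → ℝ, g (z 0) * h (z 1) = (∫⁻ t, g t) * ∫⁻ t, h t := by
    rw [← lintegral_prod_mul hg.aemeasurable hh.aemeasurable]
    exact (volume_preserving_finTwoArrow ℝ).lintegral_comp
      (f := fun z : ℝ × ℝ => g z.1 * h z.2) (by fun_prop)
  rw [← e1, ← lintegral_prod_mul hf.aemeasurable (by fun_prop)]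
  have e2 := (volume_preserving_piFinSuccAbove (fun _ : Fin 3 => ℝ) 0).lintegral_comp
    (f := fun z : ℝ × (Fin 2 → ℝ) => f z.1 * (g (z.2 0) * h (z.2 1))) (by fun_prop)
  refine Eq.trans ?_ e2
  exact (PiLp.volume_preserving_ofLp (Fin 3)).lintegral_comp
    (f := fun y : Fin 3 → ℝ => f (y 0) * (g (y 1) * h (y 2))) (by fun_prop)

end Product

/-! ### The Schur test. -/

section Schur

/-- **Schur test** for positive kernels. -/
lemma schur_test {α : Type*} [MeasurableSpace α] {μ : Measure α} [SFinite μ]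
    {k : α → α → ENNReal} (hk : Measurable (Function.uncurry k)) {w : α → ENNReal}
    (hw : Measurable w) (hw0 : ∀ᵐ x ∂μ, w x ≠ 0 ∧ w x ≠ ⊤) {p q : ℝ} (hpq : p.HolderConjugate q)
    {A B : ENNReal}
    (h1 : ∀ᵐ x ∂μ, ∫⁻ y, k x y * w y ^ q ∂μ ≤ A * w x ^ q)
    (h2 : ∀ᵐ y ∂μ, ∫⁻ x, k x y * w x ^ p ∂μ ≤ B * w y ^ p)
    {f : α → ENNReal} (hf : Measurable f) :
    ∫⁻ x, (∫⁻ y, k x y * f y ∂μ) ^ p ∂μ ≤ A ^ (p / q) * B * ∫⁻ y, f y ^ p ∂μ := by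
  have hp := hpq.pos
  have hq := hpq.symm.pos
  have hkx : ∀ x, Measurable (k x) := fun x => hk.comp measurable_prodMk_left
  have hstep : ∀ᵐ x ∂μ, (∫⁻ y, k x y * f y ∂μ) ^ p
      ≤ A ^ (p / q) * ∫⁻ y, w x ^ p * (k x y * ((w y)⁻¹ ^ p * f y ^ p)) ∂μ := by
    filter_upwards [h1] with x hx
    -- Hölder after splitting `k = k^{1/p} k^{1/q}` and inserting `w⁻¹ w = 1`.
    have hh := ENNReal.lintegral_mul_le_Lp_mul_Lq μ hpq
      (f := fun y => k x y ^ (1 / p) * ((w y)⁻¹ * f y)) (g := fun y => k x y ^ (1 / q) * w y)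
      (((hkx x).pow_const _).mul (hw.inv.mul hf)).aemeasurable
      (((hkx x).pow_const _).mul hw).aemeasurable
    have e1 : ∫⁻ y, k x y * f y ∂μ = ∫⁻ y, ((fun y => k x y ^ (1 / p) * ((w y)⁻¹ * f y))
        * fun y => k x y ^ (1 / q) * w y) y ∂μ := by
      refine lintegral_congr_ae ?_
      filter_upwards [hw0] with y hy
      simp only [Pi.mul_apply]
      have : k x y = k x y ^ (1 / p) * k x y ^ (1 / q) := by
        rw [← ENNReal.rpow_add_of_nonneg _ _ (by positivity) (by positivity), one_div, one_div,
          hpq.inv_add_inv_eq_one, ENNReal.rpow_one]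
      calc k x y * f y = (k x y ^ (1 / p) * k x y ^ (1 / q)) * ((w y)⁻¹ * w y) * f y := by
            rw [← this, ENNReal.inv_mul_cancel hy.1 hy.2, mul_one]
        _ = _ := by ring
    have e2 : ∀ y, (k x y ^ (1 / p) * ((w y)⁻¹ * f y)) ^ p = k x y * ((w y)⁻¹ ^ p * f y ^ p) := by
      intro y
      rw [ENNReal.mul_rpow_of_nonneg _ _ hp.le, ENNReal.mul_rpow_of_nonneg _ _ hp.le,
        ← ENNReal.rpow_mul, one_div_mul_cancel hp.ne', ENNReal.rpow_one]
    have e3 : ∀ y, (k x y ^ (1 / q) * w y) ^ q = k x y * w y ^ q := by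
      intro y
      rw [ENNReal.mul_rpow_of_nonneg _ _ hq.le, ← ENNReal.rpow_mul, one_div_mul_cancel hq.ne',
        ENNReal.rpow_one]
    rw [e1]
    calc _ ≤ ((∫⁻ y, k x y * ((w y)⁻¹ ^ p * f y ^ p) ∂μ) ^ (1 / p)
          * (A * w x ^ q) ^ (1 / q)) ^ p := by
          gcongr
          refine hh.trans ?_
          simp only [e2, e3]
          gcongr
      _ = A ^ (p / q) * ∫⁻ y, w x ^ p * (k x y * ((w y)⁻¹ ^ p * f y ^ p)) ∂μ := by
          rw [ENNReal.mul_rpow_of_nonneg _ _ hp.le, ← ENNReal.rpow_mul, one_div_mul_cancel hp.ne',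
            ENNReal.rpow_one, ← ENNReal.rpow_mul, one_div_mul_eq_div,
            ENNReal.mul_rpow_of_nonneg _ _ (by positivity), ← ENNReal.rpow_mul,
            mul_div_cancel₀ _ hq.ne', lintegral_const_mul]
          · ring
          · exact (hkx x).mul ((hw.inv.pow_const _).mul (hf.pow_const _))
  calc _ ≤ ∫⁻ x, A ^ (p / q) * ∫⁻ y, w x ^ p * (k x y * ((w y)⁻¹ ^ p * f y ^ p)) ∂μ ∂μ :=
        lintegral_mono_ae hstep
    _ = A ^ (p / q) * ∫⁻ y, ∫⁻ x, w x ^ p * (k x y * ((w y)⁻¹ ^ p * f y ^ p)) ∂μ ∂μ := by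
        have hm : Measurable (Function.uncurry fun x y =>
            w x ^ p * (k x y * ((w y)⁻¹ ^ p * f y ^ p))) := by
          unfold Function.uncurry at hk ⊢
          fun_prop
        rw [lintegral_const_mul, lintegral_lintegral_swap hm.aemeasurable]
        exact hm.lintegral_prod_right
    _ ≤ A ^ (p / q) * ∫⁻ y, B * f y ^ p ∂μ := by
        gcongr 1
        refine lintegral_mono_ae ?_
        filter_upwards [h2, hw0] with y hy hwy
        calc _ = ∫⁻ x, (k x y * w x ^ p) * ((w y)⁻¹ ^ p * f y ^ p) ∂μ := by
              congr 1 with x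
              ring
          _ = (∫⁻ x, k x y * w x ^ p ∂μ) * ((w y)⁻¹ ^ p * f y ^ p) := by
              rw [lintegral_mul_const]
              exact (hk.comp measurable_prodMk_right).mul (hw.pow_const _)
          _ ≤ (B * w y ^ p) * ((w y)⁻¹ ^ p * f y ^ p) := by gcongr
          _ = B * (w y * (w y)⁻¹) ^ p * f y ^ p := by
              rw [ENNReal.mul_rpow_of_nonneg _ _ hp.le]
              ring
          _ = B * f y ^ p := by
              rw [ENNReal.mul_inv_cancel hwy.1 hwy.2, ENNReal.one_rpow, mul_one]
    _ = _ := by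
        rw [lintegral_const_mul _ (hf.pow_const _), mul_assoc]

end Schur

/-! ### Power weights for the dominating kernel. -/

section Weight

/-- To separate the variables, the exponent 2 of `D = |x - y|` is split as `2δ + (1 - δ) + (1 - δ)`
and the exponent 1 of the maximum as `(1 - 4δ) + 2δ + 2δ`. Lower bounds for `D` and the maximum are
then inserted factor by factor. In `y₂` and `y₃` this leaves a singularity of order `1 - δ < 1` and
decay of order `1 + δ > 1`. -/
lemma domKernel_le {δ : ℝ} (hδ : 0 < δ) (hδ' : δ < 1 / 4) {x y : E3}
    (h0 : x 0 - y 0 ≠ 0) (h1 : x 1 - y 1 ≠ 0) (h2 : x 2 - y 2 ≠ 0) (hx : x 0 ≠ 0) :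
    domKernel x y ≤ (|x 0 - y 0| ^ (-(2 * δ)) * (max |x 0| |y 0|) ^ (-(1 - 4 * δ)))
      * (profile (1 - δ) (2 * δ) |x 0| (x 1 - y 1) * profile (1 - δ) (2 * δ) |x 0| (x 2 - y 2)) := by
  have a0 : |x 0 - y 0| ≤ ‖x - y‖ := abs_apply_le_norm (x - y) 0
  have a1 : |x 1 - y 1| ≤ ‖x - y‖ := abs_apply_le_norm (x - y) 1
  have a2 : |x 2 - y 2| ≤ ‖x - y‖ := abs_apply_le_norm (x - y) 2
  have p0 := abs_pos.2 h0
  have p1 := abs_pos.2 h1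
  have p2 := abs_pos.2 h2
  have px := abs_pos.2 hx
  set D := ‖x - y‖
  set M := max D (max |x 0| |y 0|)
  have hD : 0 < D := p0.trans_le a0
  have hM : 0 < M := hD.trans_le (le_max_left _ _)
  have hMx : |x 0| ≤ M := (le_max_left _ _).trans (le_max_right _ _)
  have hDM : D ≤ M := le_max_left _ _
  have hmM : max |x 0| |y 0| ≤ M := le_max_right _ _
  have hk : domKernel x y = (D ^ (-(2 * δ)) * M ^ (-(1 - 4 * δ)))
      * ((D ^ (-(1 - δ)) * M ^ (-(2 * δ))) * (D ^ (-(1 - δ)) * M ^ (-(2 * δ)))) := by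
    have e1 : D ^ (-(2 * δ)) * (D ^ (-(1 - δ)) * D ^ (-(1 - δ))) = D⁻¹ ^ 2 := by
      rw [← Real.rpow_add hD, ← Real.rpow_add hD,
        show -(2 * δ) + (-(1 - δ) + -(1 - δ)) = -((2 : ℕ) : ℝ) by push_cast; ring,
        Real.rpow_neg hD.le, Real.rpow_natCast, inv_pow]
    have e2 : M ^ (-(1 - 4 * δ)) * (M ^ (-(2 * δ)) * M ^ (-(2 * δ))) = M⁻¹ := by
      rw [← Real.rpow_add hM, ← Real.rpow_add hM,
        show -(1 - 4 * δ) + (-(2 * δ) + -(2 * δ)) = -1 by ring, Real.rpow_neg_one]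
    unfold domKernel
    rw [← e1, ← e2]
    ring
  have hpr : ∀ t : ℝ, 0 < |t| → |t| ≤ D → D ^ (-(1 - δ)) * M ^ (-(2 * δ))
      ≤ profile (1 - δ) (2 * δ) |x 0| t := by
    intro t ht htD
    unfold profile
    gcongr ?_ * ?_
    · exact Real.rpow_le_rpow_of_nonpos ht htD (by linarith)
    · exact Real.rpow_le_rpow_of_nonpos (ht.trans_le (le_max_left _ _))
        (max_le (htD.trans hDM) hMx) (by linarith)
  rw [hk]
  gcongr ?_ * ?_ * (?_ * ?_)
  · exact Real.rpow_le_rpow_of_nonpos p0 a0 (by linarith)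
  · exact Real.rpow_le_rpow_of_nonpos (px.trans_le (le_max_left _ _)) hmM (by linarith)
  · exact profile_nonneg
  · exact hpr _ p1 a1
  · exact hpr _ p2 a2

/-- In `|s - t|^{-2δ} |t|^{-a}` both bases may be replaced by the smaller one, which is covered by
summing the two cases. The maximum is compared with `max |s - t| |s|` and `max |t| |s|` at the cost
of a factor 2. -/
lemma axial_factor_le {δ a s t : ℝ} (hδ : 0 < δ) (hδ' : δ < 1 / 4) (ha : 0 < a)
    (h0 : s - t ≠ 0) (hs : s ≠ 0) (ht : t ≠ 0) :
    |s - t| ^ (-(2 * δ)) * (max |s| |t|) ^ (-(1 - 4 * δ)) * |t| ^ (-a)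
      ≤ 2 * (profile (2 * δ + a) (1 - 4 * δ) |s| (s - t) + profile (2 * δ + a) (1 - 4 * δ) |s| t) := by
  have p0 := abs_pos.2 h0
  have ps := abs_pos.2 hs
  have pt := abs_pos.2 ht
  have hm : 0 < max |s| |t| := ps.trans_le (le_max_left _ _)
  have h1 : |s - t| ^ (-(2 * δ)) * |t| ^ (-a)
      ≤ |s - t| ^ (-(2 * δ + a)) + |t| ^ (-(2 * δ + a)) := by
    rcases le_total |s - t| |t| with h | h
    · have : |t| ^ (-a) ≤ |s - t| ^ (-a) := Real.rpow_le_rpow_of_nonpos p0 h (by linarith)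
      calc _ ≤ |s - t| ^ (-(2 * δ)) * |s - t| ^ (-a) := by gcongr
        _ = |s - t| ^ (-(2 * δ + a)) := by rw [← Real.rpow_add p0]; congr 1; ring
        _ ≤ _ := le_add_of_nonneg_right (by positivity)
    · have : |s - t| ^ (-(2 * δ)) ≤ |t| ^ (-(2 * δ)) :=
        Real.rpow_le_rpow_of_nonpos pt h (by linarith)
      calc _ ≤ |t| ^ (-(2 * δ)) * |t| ^ (-a) := by gcongr
        _ = |t| ^ (-(2 * δ + a)) := by rw [← Real.rpow_add pt]; congr 1; ring
        _ ≤ _ := le_add_of_nonneg_left (by positivity)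
  have h2 : (max |s| |t|) ^ (-(1 - 4 * δ)) ≤ 2 * (max |s - t| |s|) ^ (-(1 - 4 * δ)) := by
    have h3 : max |s - t| |s| ≤ 2 * max |s| |t| := by
      have := abs_sub s t
      have := le_max_left |s| |t|
      have := le_max_right |s| |t|
      exact max_le (by linarith) (by linarith)
    have h4 : (2 * max |s| |t|) ^ (-(1 - 4 * δ)) ≤ (max |s - t| |s|) ^ (-(1 - 4 * δ)) :=
      Real.rpow_le_rpow_of_nonpos (ps.trans_le (le_max_right _ _)) h3 (by linarith)
    rw [Real.mul_rpow (by norm_num) hm.le] at h4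
    have h5 : (1 / 2 : ℝ) ≤ 2 ^ (-(1 - 4 * δ)) := by
      calc (1 / 2 : ℝ) = 2 ^ (-1 : ℝ) := by rw [Real.rpow_neg_one]; norm_num
        _ ≤ _ := Real.rpow_le_rpow_of_exponent_le (by norm_num) (by linarith)
    have h6 : 0 ≤ (max |s| |t|) ^ (-(1 - 4 * δ)) := by positivity
    nlinarith
  have h3 : (max |s| |t|) ^ (-(1 - 4 * δ)) ≤ 2 * (max |t| |s|) ^ (-(1 - 4 * δ)) := by
    rw [max_comm]
    have : 0 ≤ (max |t| |s|) ^ (-(1 - 4 * δ)) := by positivity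
    linarith
  unfold profile
  calc _ = (|s - t| ^ (-(2 * δ)) * |t| ^ (-a)) * (max |s| |t|) ^ (-(1 - 4 * δ)) := by ring
    _ ≤ (|s - t| ^ (-(2 * δ + a)) + |t| ^ (-(2 * δ + a))) * (max |s| |t|) ^ (-(1 - 4 * δ)) := by
        gcongr
    _ = |s - t| ^ (-(2 * δ + a)) * (max |s| |t|) ^ (-(1 - 4 * δ))
        + |t| ^ (-(2 * δ + a)) * (max |s| |t|) ^ (-(1 - 4 * δ)) := by ring
    _ ≤ |s - t| ^ (-(2 * δ + a)) * (2 * (max |s - t| |s|) ^ (-(1 - 4 * δ)))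
        + |t| ^ (-(2 * δ + a)) * (2 * (max |t| |s|) ^ (-(1 - 4 * δ))) := by gcongr
    _ = _ := by ring

lemma lintegral_domKernel_weight {a : ℝ} (ha : 0 < a) (ha' : a < 1) :
    ∃ C : ENNReal, C ≠ ⊤ ∧ ∀ x : E3, x 0 ≠ 0 →
      ∫⁻ y, ENNReal.ofReal (domKernel x y) * ENNReal.ofReal (|y 0| ^ (-a))
        ≤ C * ENNReal.ofReal (|x 0| ^ (-a)) := by
  -- The axial profile has singular exponent `2δ + a`, which must be below 1, and total exponent `1
  -- + a - 2δ`, which must exceed 1.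
  obtain ⟨δ, hδ, hδ1, hδ2, hδ3⟩ : ∃ δ : ℝ, 0 < δ ∧ 2 * δ < a ∧ 2 * δ + a < 1 ∧ δ < 1 / 4 := by
    refine ⟨min a (1 - a) / 4, ?_, ?_, ?_, ?_⟩ <;>
      rcases min_cases a (1 - a) with h | h <;> linarith
  obtain ⟨A, hA, hA'⟩ := lintegral_profile (c := 1 - δ) (e := 2 * δ) (by linarith) (by linarith)
  obtain ⟨B, hB, hB'⟩ := lintegral_profile (c := 2 * δ + a) (e := 1 - 4 * δ) (by linarith)
    (by linarith)
  refine ⟨ENNReal.ofReal (4 * B * A * A), ENNReal.ofReal_ne_top, fun x hx => ?_⟩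
  have px := abs_pos.2 hx
  set F : ℝ → ENNReal := fun t => ENNReal.ofReal 2 * (ENNReal.ofReal (profile (2 * δ + a) (1 - 4 * δ) |x 0| (x 0 - t))
    + ENNReal.ofReal (profile (2 * δ + a) (1 - 4 * δ) |x 0| t))
  set G : Fin 3 → ℝ → ENNReal := fun i t =>
    ENNReal.ofReal (profile (1 - δ) (2 * δ) |x 0| (x i - t))
  have hFm : Measurable F := by
    have := measurable_profile (2 * δ + a) (1 - 4 * δ) |x 0|
    fun_prop
  have hGm : ∀ i, Measurable (G i) := fun i => by
    have := measurable_profile (1 - δ) (2 * δ) |x 0|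
    fun_prop
  have hG : ∀ i, ∫⁻ t, G i t ≤ ENNReal.ofReal (A * |x 0| ^ (-δ)) := fun i => by
    refine (le_of_eq ?_).trans ((hA' _ px).trans (le_of_eq ?_))
    · exact lintegral_sub_left_eq_self
        (fun t => ENNReal.ofReal (profile (1 - δ) (2 * δ) |x 0| t)) (x i)
    · congr 3
      ring
  have hF : ∫⁻ t, F t ≤ ENNReal.ofReal (4 * B * |x 0| ^ (2 * δ - a)) := by
    have h1 := hB' _ px
    have hm := (measurable_profile (2 * δ + a) (1 - 4 * δ) |x 0|).ennreal_ofReal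
    rw [lintegral_const_mul, lintegral_add_right _ hm, lintegral_sub_left_eq_self
        (fun t => ENNReal.ofReal (profile (2 * δ + a) (1 - 4 * δ) |x 0| t)) (x 0)]
    · calc _ ≤ ENNReal.ofReal 2 * (ENNReal.ofReal (B * |x 0| ^ (1 - (2 * δ + a) - (1 - 4 * δ)))
            + ENNReal.ofReal (B * |x 0| ^ (1 - (2 * δ + a) - (1 - 4 * δ)))) := by gcongr
        _ = _ := by
            rw [← ENNReal.ofReal_add (by positivity) (by positivity),
              ← ENNReal.ofReal_mul (by norm_num)]
            congr 1
            rw [show 1 - (2 * δ + a) - (1 - 4 * δ) = 2 * δ - a by ring]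
            ring
    · exact (hm.comp (measurable_const.sub measurable_id)).add hm
  calc _ ≤ ∫⁻ y : E3, F (y 0) * (G 1 (y 1) * G 2 (y 2)) := by
        refine lintegral_mono_ae ?_
        filter_upwards [ae_apply_ne 0 (x 0), ae_apply_ne 1 (x 1), ae_apply_ne 2 (x 2),
          ae_apply_ne 0 0] with y h0 h1 h2 hy
        have n0 := sub_ne_zero.2 h0.symm
        have k1 := domKernel_le hδ hδ3 n0 (sub_ne_zero.2 h1.symm) (sub_ne_zero.2 h2.symm) hx
        have k2 := axial_factor_le hδ hδ3 ha n0 hx hy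
        simp only [F, G]
        rw [← ENNReal.ofReal_add profile_nonneg profile_nonneg,
          ← ENNReal.ofReal_mul zero_le_two, ← ENNReal.ofReal_mul profile_nonneg,
          ← ENNReal.ofReal_mul (mul_nonneg zero_le_two (add_nonneg profile_nonneg profile_nonneg)),
          ← ENNReal.ofReal_mul (domKernel_nonneg _ _)]
        refine ENNReal.ofReal_le_ofReal ?_
        calc _ ≤ _ * |y 0| ^ (-a) := mul_le_mul_of_nonneg_right k1 (by positivity)
          _ = (|x 0 - y 0| ^ (-(2 * δ)) * (max |x 0| |y 0|) ^ (-(1 - 4 * δ)) * |y 0| ^ (-a))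
              * (profile (1 - δ) (2 * δ) |x 0| (x 1 - y 1)
                * profile (1 - δ) (2 * δ) |x 0| (x 2 - y 2)) := by ring
          _ ≤ _ := mul_le_mul_of_nonneg_right k2 (mul_nonneg profile_nonneg profile_nonneg)
    _ = (∫⁻ t, F t) * ((∫⁻ t, G 1 t) * ∫⁻ t, G 2 t) := lintegral_fin_three hFm (hGm 1) (hGm 2)
    _ ≤ ENNReal.ofReal (4 * B * |x 0| ^ (2 * δ - a)) * (ENNReal.ofReal (A * |x 0| ^ (-δ))
        * ENNReal.ofReal (A * |x 0| ^ (-δ))) := by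
        gcongr
        · exact hG 1
        · exact hG 2
    _ = _ := by
        rw [← ENNReal.ofReal_mul (by positivity), ← ENNReal.ofReal_mul (by positivity),
          ← ENNReal.ofReal_mul (by positivity)]
        congr 1
        have : |x 0| ^ (2 * δ - a) * (|x 0| ^ (-δ) * |x 0| ^ (-δ)) = |x 0| ^ (-a) := by
          rw [← Real.rpow_add px, ← Real.rpow_add px]
          congr 1
          ring
        rw [← this]
        ring

end Weight

lemma lintegral_domOp_rpow_le {p : ℝ} (hp : 1 < p) :
    ∃ C : ENNReal, C ≠ ⊤ ∧ ∀ g : E3 → ENNReal, Measurable g →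
      ∫⁻ x, domOp g x ^ p ≤ C * ∫⁻ x, g x ^ p := by
  have hpq : p.HolderConjugate (p / (p - 1)) := Real.HolderConjugate.conjExponent hp
  have hp0 : 0 < p := by linarith
  set q := p / (p - 1) with hq
  have hp1 : 0 < p - 1 := by linarith
  -- The Schur weight is `|x₁|^{-a/q}`. Since `p / q = p - 1`, its powers `q` and `p` are
  -- `|x₁|^{-a}` and `|x₁|^{-a(p-1)}`, and this `a` puts both exponents in `(0, 1)`.
  set a : ℝ := 1 / (2 * p) with ha
  have ha0 : 0 < a := by positivity
  have ha1 : a < 1 := by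
    rw [ha, div_lt_one (by positivity)]; linarith
  have ha2 : 0 < a * (p - 1) := by positivity
  have ha3 : a * (p - 1) < 1 := by
    rw [ha, div_mul_eq_mul_div, div_lt_one (by positivity)]; linarith
  obtain ⟨A, hA, hA'⟩ := lintegral_domKernel_weight ha0 ha1
  obtain ⟨B, hB, hB'⟩ := lintegral_domKernel_weight ha2 ha3
  refine ⟨A ^ (p / q) * B, ENNReal.mul_ne_top (ENNReal.rpow_ne_top_of_nonneg
    (div_nonneg hp0.le hpq.symm.nonneg) hA) hB, fun g hg => ?_⟩
  set w : E3 → ENNReal := fun y => ENNReal.ofReal (|y 0| ^ (-(a / q)))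
  have hwq : ∀ y, w y ^ q = ENNReal.ofReal (|y 0| ^ (-a)) := fun y => by
    rw [ENNReal.ofReal_rpow_of_nonneg (by positivity) hpq.symm.nonneg, ← Real.rpow_mul (abs_nonneg _)]
    congr 2
    have := hpq.symm.pos.ne'
    field_simp
  have hwp : ∀ y, w y ^ p = ENNReal.ofReal (|y 0| ^ (-(a * (p - 1)))) := fun y => by
    rw [ENNReal.ofReal_rpow_of_nonneg (by positivity) hp0.le, ← Real.rpow_mul (abs_nonneg _)]
    congr 2
    rw [hq]
    field_simp
  refine schur_test (k := fun x y => ENNReal.ofReal (domKernel x y)) (w := w)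
    measurable_domKernel.ennreal_ofReal (by fun_prop) ?_ hpq ?_ ?_ hg
  · filter_upwards [ae_apply_ne 0 0] with y hy
    have := abs_pos.2 hy
    refine ⟨?_, ENNReal.ofReal_ne_top⟩
    rw [ENNReal.ofReal_ne_zero_iff]
    positivity
  · filter_upwards [ae_apply_ne 0 0] with x hx
    simp only [hwq]
    exact hA' x hx
  · filter_upwards [ae_apply_ne 0 0] with y hy
    simp only [hwp, domKernel_comm _ y]
    exact hB' y hy

/-! ### Dyadic decomposition of level sets. -/

section Dyadic

/-- The quantity `t d_f(t)^{1/p}` whose `L^q(dt/t)` norm is the Lorentz norm. -/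
def lorentzProfile (p : ℝ) (f : E3 → ℝ) (t : ℝ) : ENNReal :=
  ENNReal.ofReal t * distrib f t ^ (1 / p)

lemma lorentzProfile_rpow {p : ℝ} (hp : 0 < p) (f : E3 → ℝ) (t : ℝ) :
    lorentzProfile p f t ^ p = ENNReal.ofReal t ^ p * distrib f t := by
  rw [lorentzProfile, ENNReal.mul_rpow_of_nonneg _ _ hp.le, ← ENNReal.rpow_mul,
    one_div_mul_cancel hp.ne', ENNReal.rpow_one]

lemma distrib_antitone (f : E3 → ℝ) : Antitone (distrib f) := fun _ _ h =>
  measure_mono fun _ hx => h.trans_lt hx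

lemma measurable_lorentzProfile (p : ℝ) (f : E3 → ℝ) : Measurable (lorentzProfile p f) :=
  ENNReal.measurable_ofReal.mul ((distrib_antitone f).measurable.pow_const _)

lemma ofReal_zpow_mul (n : ℤ) (t : ℝ) :
    ENNReal.ofReal ((2 : ℝ) ^ n * t) = (2 : ENNReal) ^ (n : ℝ) * ENNReal.ofReal t := by
  rw [ENNReal.ofReal_mul (by positivity), ← Real.rpow_intCast, ← ENNReal.ofReal_rpow_of_pos two_pos,
    ENNReal.ofReal_ofNat]

lemma two_rpow_mul_self (x y : ℝ) : (2 : ENNReal) ^ x * 2 ^ y = 2 ^ (x + y) :=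
  (ENNReal.rpow_add _ _ two_ne_zero ENNReal.ofNat_ne_top).symm

lemma two_rpow_le {x y : ℝ} (h : x ≤ y) : (2 : ENNReal) ^ x ≤ 2 ^ y :=
  ENNReal.rpow_le_rpow_of_exponent_le (by norm_num) h

-- Each nonzero value of `|f|` lies in exactly one band `(2ⁿ t, 2ⁿ⁺¹ t]`, whose measure is at most
-- the distribution function at its lower end. The predicate `P` holds for every band that meets
-- `A`.
open Classical in
lemma lintegral_indicator_rpow_le {f : E3 → ℝ} (hf : Measurable f) {t : ℝ} (ht : 0 < t)
    {A : Set E3} {P : ℤ → Prop}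
    (hP : ∀ x ∈ A, ∀ n : ℤ, (2 : ℝ) ^ n * t < |f x| → |f x| ≤ (2 : ℝ) ^ (n + 1) * t → P n)
    {s : ℝ} (hs : 0 < s) :
    ∫⁻ x, (A.indicator (fun y => ‖f y‖ₑ) x) ^ s ≤ ∑' n : ℤ,
      (if P n then ENNReal.ofReal ((2 : ℝ) ^ (n + 1) * t) ^ s else 0)
        * distrib f ((2 : ℝ) ^ n * t) := by
  have hmeas : ∀ n : ℤ, MeasurableSet {x | (2 : ℝ) ^ n * t < |f x|} := fun n =>
    measurableSet_lt measurable_const hf.norm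
  calc _ ≤ ∫⁻ x, ∑' n : ℤ, {x | (2 : ℝ) ^ n * t < |f x|}.indicator
        (fun _ => if P n then ENNReal.ofReal ((2 : ℝ) ^ (n + 1) * t) ^ s else 0) x := by
        refine lintegral_mono fun x => ?_
        by_cases hx : x ∈ A
        · by_cases h0 : f x = 0
          · simp [hx, h0, hs]
          obtain ⟨n, hn1, hn2⟩ := exists_mem_Ioc_zpow (x := |f x| / t) (y := (2 : ℝ))
            (div_pos (abs_pos.2 h0) ht) one_lt_two
          rw [lt_div_iff₀ ht] at hn1
          rw [div_le_iff₀ ht] at hn2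
          refine le_trans ?_ (ENNReal.le_tsum n)
          rw [Set.indicator_of_mem hx, Set.indicator_of_mem (by exact hn1),
            if_pos (hP x hx n hn1 hn2), ← ofReal_norm]
          gcongr
          exact hn2
        · simp [hx, hs]
    _ = _ := by
        rw [lintegral_tsum fun n => (measurable_const.indicator (hmeas n)).aemeasurable]
        congr 1 with n
        rw [lintegral_indicator_const (hmeas n)]
        rfl

/-- Expressing the distribution function through `lorentzProfile ^ p` gives band `n` the factor
`2^{(n+1)s - np}`; `hL` says that it decays geometrically in `|n|` over the bands in `P`. -/
lemma rpow_mul_lintegral_indicator_le {f : E3 → ℝ} (hf : Measurable f) {t : ℝ} (ht : 0 < t)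
    {A : Set E3} {P : ℤ → Prop}
    (hP : ∀ x ∈ A, ∀ n : ℤ, (2 : ℝ) ^ n * t < |f x| → |f x| ≤ (2 : ℝ) ^ (n + 1) * t → P n)
    {s p L ε : ℝ} (hs : 0 < s) (hp : 0 < p)
    (hL : ∀ n : ℤ, P n → ((n : ℝ) + 1) * s - n * p ≤ L - ε * n.natAbs) :
    ENNReal.ofReal t ^ p * ∫⁻ x, (A.indicator (fun y => ‖f y‖ₑ) x) ^ s
      ≤ 2 ^ L * ENNReal.ofReal t ^ s
        * ∑' n : ℤ, (2 ^ (-ε)) ^ n.natAbs * lorentzProfile p f ((2 : ℝ) ^ n * t) ^ p := by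
  classical
  calc _ ≤ ENNReal.ofReal t ^ p * _ := by
        gcongr
        exact lintegral_indicator_rpow_le hf ht hP hs
    _ = ∑' n : ℤ, ENNReal.ofReal t ^ p *
        ((if P n then ENNReal.ofReal ((2 : ℝ) ^ (n + 1) * t) ^ s else 0)
        * distrib f ((2 : ℝ) ^ n * t)) := ENNReal.tsum_mul_left.symm
    _ ≤ ∑' n : ℤ, 2 ^ L * ENNReal.ofReal t ^ s
        * ((2 ^ (-ε)) ^ n.natAbs * lorentzProfile p f ((2 : ℝ) ^ n * t) ^ p) := by
        refine ENNReal.tsum_le_tsum fun n => ?_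
        by_cases h : P n
        · rw [if_pos h, lorentzProfile_rpow hp, ofReal_zpow_mul, ofReal_zpow_mul,
            ENNReal.mul_rpow_of_nonneg _ _ hs.le, ENNReal.mul_rpow_of_nonneg _ _ hp.le,
            ← ENNReal.rpow_mul, ← ENNReal.rpow_mul, ← ENNReal.rpow_mul_natCast]
          set τ := ENNReal.ofReal t
          set d := distrib f ((2 : ℝ) ^ n * t)
          push_cast
          calc _ = (2 : ENNReal) ^ (((n : ℝ) + 1) * s) * (τ ^ p * τ ^ s * d) := by ring
            _ ≤ (2 : ENNReal) ^ (L + (-ε * n.natAbs + n * p)) * (τ ^ p * τ ^ s * d) := by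
                gcongr 1
                exact two_rpow_le (by have := hL n h; linarith)
            _ = _ := by
                rw [← two_rpow_mul_self, ← two_rpow_mul_self]
                ring
        · rw [if_neg h, zero_mul, mul_zero]
          exact zero_le
    _ = _ := ENNReal.tsum_mul_left

/-- Above the level `t`, for exponents `s < p`. -/
lemma rpow_mul_lintegral_above_le {f : E3 → ℝ} (hf : Measurable f) {t : ℝ} (ht : 0 < t)
    {s p : ℝ} (hs : 0 < s) (hp : 0 < p) :
    ENNReal.ofReal t ^ p * ∫⁻ x, ({x | t < |f x|}.indicator (fun y => ‖f y‖ₑ) x) ^ s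
      ≤ 2 ^ s * ENNReal.ofReal t ^ s
        * ∑' n : ℤ, (2 ^ (-(p - s))) ^ n.natAbs * lorentzProfile p f ((2 : ℝ) ^ n * t) ^ p := by
  refine rpow_mul_lintegral_indicator_le (P := fun n => 0 ≤ n) hf ht ?_ hs hp ?_
  · intro x hx n _ h2
    have h3 : (1 : ℝ) < 2 ^ (n + 1) := by
      have hx' : t < |f x| := hx
      by_contra! h
      nlinarith
    have := (one_lt_zpow_iff_right₀ (one_lt_two : (1 : ℝ) < 2)).1 h3
    show 0 ≤ n
    omega
  · intro n hn
    have : ((n.natAbs : ℕ) : ℝ) = n := by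
      rw [← Int.cast_natCast, Int.natAbs_of_nonneg hn]
    rw [this]
    linarith

/-- Below the level `t`, for exponents `s > p`. -/
lemma rpow_mul_lintegral_below_le {f : E3 → ℝ} (hf : Measurable f) {t : ℝ} (ht : 0 < t)
    {s p : ℝ} (hs : 0 < s) (hp : 0 < p) :
    ENNReal.ofReal t ^ p * ∫⁻ x, ({x | t < |f x|}ᶜ.indicator (fun y => ‖f y‖ₑ) x) ^ s
      ≤ 2 ^ s * ENNReal.ofReal t ^ s
        * ∑' n : ℤ, (2 ^ (-(s - p))) ^ n.natAbs * lorentzProfile p f ((2 : ℝ) ^ n * t) ^ p := by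
  refine rpow_mul_lintegral_indicator_le (P := fun n => n ≤ 0) hf ht ?_ hs hp ?_
  · intro x hx n h1 _
    have h3 : (2 : ℝ) ^ n < 1 := by
      have hx' : |f x| ≤ t := not_lt.1 hx
      by_contra! h
      nlinarith
    exact ((zpow_lt_one_iff_right₀ (one_lt_two : (1 : ℝ) < 2)).1 h3).le
  · intro n hn
    have : ((n.natAbs : ℕ) : ℝ) = -n := by
      rw [← Int.cast_natCast, Int.ofNat_natAbs_of_nonpos hn, Int.cast_neg]
    rw [this]
    linarith

lemma two_rpow_neg_lt_one {ε : ℝ} (hε : 0 < ε) : (2 : ENNReal) ^ (-ε) < 1 :=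
  ENNReal.rpow_lt_one_of_one_lt_of_neg (by norm_num) (by linarith)

lemma tsum_pow_natAbs_ne_top {ρ : ENNReal} (hρ : ρ < 1) : ∑' n : ℤ, ρ ^ n.natAbs ≠ ⊤ := by
  have h1 : ∑' n : ℕ, ρ ^ n ≠ ⊤ := by
    rw [ENNReal.tsum_geometric]
    exact ENNReal.inv_ne_top.2 (tsub_pos_of_lt hρ).ne'
  rw [tsum_of_nat_of_neg_add_one ENNReal.summable ENNReal.summable]
  refine ENNReal.add_ne_top.2 ⟨by simpa using h1, ?_⟩
  refine ne_top_of_le_ne_top h1 (ENNReal.tsum_le_tsum fun n => ?_)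
  have : (-((n : ℤ) + 1)).natAbs = n + 1 := by omega
  rw [this, pow_succ]
  exact mul_le_of_le_one_right' hρ.le

/-- A geometrically weighted sum is controlled by the supremum of its terms, with a slightly worse
weight. -/
lemma tsum_weight_le_iSup (ρ : ENNReal) (a : ℤ → ENNReal) :
    ∑' n : ℤ, (ρ ^ 2) ^ n.natAbs * a n
      ≤ (∑' n : ℤ, ρ ^ n.natAbs) * ⨆ n : ℤ, ρ ^ n.natAbs * a n := by
  rw [← ENNReal.tsum_mul_right]
  refine ENNReal.tsum_le_tsum fun n => ?_
  rw [← pow_mul, two_mul, pow_add, mul_assoc]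
  gcongr
  exact le_iSup (fun n : ℤ => ρ ^ n.natAbs * a n) n

/-- This holds for every positive power, whereas `(∑ a)^s ≤ ∑ a^s` needs `s ≤ 1`. Hence the dyadic
estimate below is stated with a supremum. -/
lemma iSup_rpow_le_tsum (a : ℤ → ENNReal) {s : ℝ} (hs : 0 < s) :
    (⨆ n, a n) ^ s ≤ ∑' n, a n ^ s := by
  have h := (ENNReal.orderIsoRpow s hs).map_iSup a
  simp only [ENNReal.orderIsoRpow_apply] at h
  rw [h]
  exact iSup_le fun n => ENNReal.le_tsum n

end Dyadic

/-! ### Dilation invariance of `dt / t`. -/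

section Scaling

lemma lintegral_comp_mul_div {F : ℝ → ENNReal} (hF : Measurable F) {c : ℝ} (hc : 0 < c) :
    ∫⁻ t in Set.Ioi (0 : ℝ), F (c * t) / ENNReal.ofReal t
      = ∫⁻ t in Set.Ioi (0 : ℝ), F t / ENNReal.ofReal t := by
  set G : ℝ → ENNReal := (Set.Ioi (0 : ℝ)).indicator fun t => F t / ENNReal.ofReal t with hG
  have hGm : Measurable G := (hF.div ENNReal.measurable_ofReal).indicator measurableSet_Ioi
  rw [← lintegral_indicator measurableSet_Ioi, ← lintegral_indicator measurableSet_Ioi, ← hG]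
  conv_rhs => rw [← Real.smul_map_volume_mul_left hc.ne']
  rw [lintegral_smul_measure, lintegral_map hGm (by fun_prop), smul_eq_mul,
    ← lintegral_const_mul _ (by fun_prop)]
  congr 1 with t
  by_cases ht : 0 < t
  · have hct : c * t ∈ Set.Ioi (0 : ℝ) := mul_pos hc ht
    rw [hG, Set.indicator_of_mem (by exact ht), Set.indicator_of_mem hct, abs_of_pos hc,
      ENNReal.ofReal_mul hc.le, ENNReal.div_eq_inv_mul, ENNReal.div_eq_inv_mul,
      ENNReal.mul_inv (Or.inr ENNReal.ofReal_ne_top) (Or.inl ENNReal.ofReal_ne_top), ← mul_assoc,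
      ← mul_assoc, ENNReal.mul_inv_cancel (ENNReal.ofReal_pos.2 hc).ne' ENNReal.ofReal_ne_top,
      one_mul]
  · have hct : c * t ∉ Set.Ioi (0 : ℝ) := fun h => ht ((mul_pos_iff_of_pos_left hc).1 h)
    rw [hG, Set.indicator_of_notMem (by exact ht), Set.indicator_of_notMem hct, mul_zero]

end Scaling

/-! ### Interpolation to Lorentz spaces. -/

section Marcinkiewicz

lemma domOp_indicator_add {g : E3 → ENNReal} (hg : Measurable g) {A : Set E3}
    (hA : MeasurableSet A) (x : E3) :
    domOp g x = domOp (A.indicator g) x + domOp (Aᶜ.indicator g) x := by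
  unfold domOp
  rw [← lintegral_add_left]
  · congr 1 with y
    rw [← mul_add, ← Pi.add_apply, Set.indicator_self_add_compl]
  · exact (measurable_domKernel.comp measurable_prodMk_left).ennreal_ofReal.mul (hg.indicator hA)

lemma measurable_domOp {g : E3 → ENNReal} (hg : Measurable g) : Measurable (domOp g) := by
  have h : Measurable fun z : E3 × E3 => ENNReal.ofReal (domKernel z.1 z.2) * g z.2 :=
    measurable_domKernel.ennreal_ofReal.mul (hg.comp measurable_snd)
  exact h.lintegral_prod_right'

/-- Chebyshev's inequality with exponent `s` and the strong `L^s` bound, after which `t^s` is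
cancelled. -/
lemma rpow_mul_volume_le {p s : ℝ} (hs : 1 < s) {C : ENNReal} (hC : ∀ g : E3 → ENNReal,
    Measurable g → ∫⁻ x, domOp g x ^ s ≤ C * ∫⁻ x, g x ^ s) {g : E3 → ENNReal}
    (hg : Measurable g) {t : ℝ} (ht : 0 < t) {S : ENNReal}
    (hS : ENNReal.ofReal t ^ p * ∫⁻ x, g x ^ s ≤ 2 ^ s * ENNReal.ofReal t ^ s * S) :
    ENNReal.ofReal t ^ p * volume {x | ENNReal.ofReal t ≤ domOp g x} ≤ C * 2 ^ s * S := by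
  have hs0 : 0 < s := by linarith
  have h1 : ENNReal.ofReal t ^ s * volume {x | ENNReal.ofReal t ≤ domOp g x}
      ≤ C * ∫⁻ x, g x ^ s := by
    refine le_trans ?_ (hC g hg)
    have h2 := mul_meas_ge_le_lintegral (μ := volume) ((measurable_domOp hg).pow_const s)
      (ENNReal.ofReal t ^ s)
    simpa only [ENNReal.rpow_le_rpow_iff hs0] using h2
  have hτ0 : ENNReal.ofReal t ^ s ≠ 0 :=
    (ENNReal.rpow_pos (ENNReal.ofReal_pos.2 ht) ENNReal.ofReal_ne_top).ne'
  have hτ : ENNReal.ofReal t ^ s ≠ ⊤ := ENNReal.rpow_ne_top_of_nonneg hs0.le ENNReal.ofReal_ne_top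
  rw [← ENNReal.mul_le_mul_iff_right hτ0 hτ]
  calc _ = ENNReal.ofReal t ^ p *
        (ENNReal.ofReal t ^ s * volume {x | ENNReal.ofReal t ≤ domOp g x}) := by ring
    _ ≤ ENNReal.ofReal t ^ p * (C * ∫⁻ x, g x ^ s) := by gcongr
    _ = C * (ENNReal.ofReal t ^ p * ∫⁻ x, g x ^ s) := by ring
    _ ≤ C * (2 ^ s * ENNReal.ofReal t ^ s * S) := by gcongr
    _ = _ := by ring

/-- Dyadic form of the Marcinkiewicz interpolation theorem for functions dominated by `domOp`. -/
lemma exists_lorentzProfile_le {p : ℝ} (hp : 1 < p) :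
    ∃ (K ρ : ENNReal), K ≠ ⊤ ∧ ρ < 1 ∧ ∀ f g : E3 → ℝ, Measurable f →
      (∀ᵐ x, ‖g x‖ₑ ≤ domOp (fun y => ‖f y‖ₑ) x) → ∀ t, 0 < t →
      lorentzProfile p g (2 * t) ^ p
        ≤ K * ⨆ n : ℤ, ρ ^ n.natAbs * lorentzProfile p f ((2 : ℝ) ^ n * t) ^ p := by
  -- Both `p - ε` and `p + ε` then exceed 1, so strong bounds hold on either side of `p`.
  set ε := (p - 1) / 2 with hε
  have hε0 : 0 < ε := by rw [hε]; linarith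
  have hp0 : 0 < p := by linarith
  have hs0 : 1 < p - ε := by rw [hε]; linarith
  have hs1 : 1 < p + ε := by linarith
  obtain ⟨C0, hC0, hC0'⟩ := lintegral_domOp_rpow_le hs0
  obtain ⟨C1, hC1, hC1'⟩ := lintegral_domOp_rpow_le hs1
  -- Half of the decay `2^{-ε|n|}` is spent on summing the series, the other half stays in the
  -- supremum.
  set ρ : ENNReal := 2 ^ (-(ε / 2)) with hρ
  have hρ1 : ρ < 1 := two_rpow_neg_lt_one (by linarith)
  have hρ2 : (2 : ENNReal) ^ (-ε) = ρ ^ 2 := by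
    rw [hρ, ← ENNReal.rpow_mul_natCast]
    congr 1
    push_cast
    ring
  have h2top : ∀ x : ℝ, (2 : ENNReal) ^ x ≠ ⊤ := fun x =>
    ENNReal.rpow_ne_top_of_ne_zero two_ne_zero ENNReal.ofNat_ne_top
  refine ⟨2 ^ p * (C0 * 2 ^ (p - ε) + C1 * 2 ^ (p + ε)) * ∑' n : ℤ, ρ ^ n.natAbs, ρ, ?_, hρ1, ?_⟩
  · exact ENNReal.mul_ne_top (ENNReal.mul_ne_top (h2top _) (ENNReal.add_ne_top.2
      ⟨ENNReal.mul_ne_top hC0 (h2top _), ENNReal.mul_ne_top hC1 (h2top _)⟩))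
      (tsum_pow_natAbs_ne_top hρ1)
  intro f g hf hfg t ht
  set S := ∑' n : ℤ, (2 ^ (-ε)) ^ n.natAbs * lorentzProfile p f ((2 : ℝ) ^ n * t) ^ p with hS
  set A : Set E3 := {x | t < |f x|} with hA
  have hAm : MeasurableSet A := measurableSet_lt measurable_const hf.norm
  set τ := ENNReal.ofReal t with hτ
  have h0 := rpow_mul_volume_le (p := p) hs0 hC0' (hf.enorm.indicator hAm) ht (by
    have := rpow_mul_lintegral_above_le hf ht (s := p - ε) (p := p) (by linarith) hp0
    rwa [sub_sub_cancel] at this)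
  have h1 := rpow_mul_volume_le (p := p) hs1 hC1' (hf.enorm.indicator hAm.compl) ht (by
    have := rpow_mul_lintegral_below_le hf ht (s := p + ε) (p := p) (by linarith) hp0
    rwa [add_sub_cancel_left] at this)
  -- `f` is cut at height `t`; where `|g| > 2t`, one of the two pieces is mapped to a value of at
  -- least `t`.
  have hd : distrib g (2 * t) ≤ volume {x | τ ≤ domOp (A.indicator fun y => ‖f y‖ₑ) x}
      + volume {x | τ ≤ domOp (Aᶜ.indicator fun y => ‖f y‖ₑ) x} := by
    refine le_trans (measure_mono_ae ?_) (measure_union_le _ _)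
    filter_upwards [hfg] with x hx hgx
    have hgx' : 2 * t < |g x| := hgx
    by_contra hc
    rw [show ({x | τ ≤ domOp (A.indicator fun y => ‖f y‖ₑ) x}
      ∪ {x | τ ≤ domOp (Aᶜ.indicator fun y => ‖f y‖ₑ) x}) x ↔
      τ ≤ domOp (A.indicator fun y => ‖f y‖ₑ) x ∨ τ ≤ domOp (Aᶜ.indicator fun y => ‖f y‖ₑ) x
      from Iff.rfl, not_or, not_le, not_le] at hc
    rw [domOp_indicator_add hf.enorm hAm] at hx
    have h3 : ENNReal.ofReal (2 * t) < τ + τ := by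
      calc ENNReal.ofReal (2 * t) ≤ ENNReal.ofReal |g x| := ENNReal.ofReal_le_ofReal hgx'.le
        _ = ‖g x‖ₑ := by rw [← ofReal_norm]; rfl
        _ ≤ _ := hx
        _ < τ + τ := ENNReal.add_lt_add hc.1 hc.2
    rw [hτ, ← ENNReal.ofReal_add ht.le ht.le, two_mul] at h3
    exact lt_irrefl _ h3
  calc lorentzProfile p g (2 * t) ^ p = 2 ^ p * (τ ^ p * distrib g (2 * t)) := by
        rw [lorentzProfile_rpow hp0, ENNReal.ofReal_mul zero_le_two,
          ENNReal.mul_rpow_of_nonneg _ _ hp0.le, ENNReal.ofReal_ofNat, mul_assoc]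
    _ ≤ 2 ^ p * (τ ^ p * (volume {x | τ ≤ domOp (A.indicator fun y => ‖f y‖ₑ) x}
      + volume {x | τ ≤ domOp (Aᶜ.indicator fun y => ‖f y‖ₑ) x})) := by gcongr
    _ ≤ 2 ^ p * (C0 * 2 ^ (p - ε) * S + C1 * 2 ^ (p + ε) * S) := by
        rw [mul_add]
        gcongr
    _ = 2 ^ p * (C0 * 2 ^ (p - ε) + C1 * 2 ^ (p + ε)) * S := by ring
    _ ≤ 2 ^ p * (C0 * 2 ^ (p - ε) + C1 * 2 ^ (p + ε)) * ((∑' n : ℤ, ρ ^ n.natAbs) *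
        ⨆ n : ℤ, ρ ^ n.natAbs * lorentzProfile p f ((2 : ℝ) ^ n * t) ^ p) := by
        gcongr
        rw [hS, hρ2]
        exact tsum_weight_le_iSup ρ _
    _ = _ := by ring

lemma lorentzNorm_top (p : ℝ) (f : E3 → ℝ) :
    lorentzNorm p ⊤ f = ⨆ (t : ℝ) (_ : 0 < t), lorentzProfile p f t := by
  simp [lorentzNorm, lorentzProfile]

lemma lorentzNorm_of_ne_top (p : ℝ) {q : ENNReal} (hq : q ≠ ⊤) (f : E3 → ℝ) :
    lorentzNorm p q f = (ENNReal.ofReal p * ∫⁻ t in Set.Ioi (0 : ℝ),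
      lorentzProfile p f t ^ q.toReal / ENNReal.ofReal t) ^ (1 / q.toReal) := by
  simp [lorentzNorm, lorentzProfile, hq]

/-- Functions dominated by `domOp |f|` obey a Lorentz norm bound. -/
lemma exists_lorentzNorm_le {p : ℝ} (hp : 1 < p) {q : ENNReal} (hq : 1 ≤ q) :
    ∃ C : ENNReal, C ≠ ⊤ ∧ ∀ f g : E3 → ℝ, Measurable f →
      (∀ᵐ x, ‖g x‖ₑ ≤ domOp (fun y => ‖f y‖ₑ) x) →
      lorentzNorm p q g ≤ C * lorentzNorm p q f := by
  have hp0 : 0 < p := by linarith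
  obtain ⟨K, ρ, hK, hρ, h⟩ := exists_lorentzProfile_le hp
  rcases eq_or_ne q ⊤ with rfl | hqt
  · refine ⟨K ^ (1 / p), ENNReal.rpow_ne_top_of_nonneg (by positivity) hK, fun f g hf hfg => ?_⟩
    rw [lorentzNorm_top, lorentzNorm_top]
    set M := ⨆ (t : ℝ) (_ : 0 < t), lorentzProfile p f t with hM
    refine iSup₂_le fun t ht => ?_
    have h1 := h f g hf hfg (t / 2) (by positivity)
    rw [mul_div_cancel₀ _ two_ne_zero] at h1
    have h2 : lorentzProfile p g t ^ p ≤ K * M ^ p := by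
      refine h1.trans ?_
      gcongr
      refine iSup_le fun n => ?_
      calc _ ≤ 1 * lorentzProfile p f ((2 : ℝ) ^ n * (t / 2)) ^ p := by
            gcongr
            exact pow_le_one' hρ.le _
        _ ≤ M ^ p := by
            rw [one_mul]
            gcongr
            exact le_iSup₂ (f := fun (t : ℝ) (_ : 0 < t) => lorentzProfile p f t)
              ((2 : ℝ) ^ n * (t / 2)) (by positivity)
    calc lorentzProfile p g t = (lorentzProfile p g t ^ p) ^ (1 / p) := by
          rw [← ENNReal.rpow_mul, mul_one_div_cancel hp0.ne', ENNReal.rpow_one]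
      _ ≤ (K * M ^ p) ^ (1 / p) := by gcongr
      _ = K ^ (1 / p) * M := by
          rw [ENNReal.mul_rpow_of_nonneg _ _ (by positivity), ← ENNReal.rpow_mul,
            mul_one_div_cancel hp0.ne', ENNReal.rpow_one]
  · set Q := q.toReal with hQ
    have hQ0 : 0 < Q := ENNReal.toReal_pos (by positivity) hqt
    set s := Q / p with hs
    have hs0 : 0 < s := by positivity
    have hps : p * s = Q := by rw [hs]; field_simp
    set W := ∑' n : ℤ, (ρ ^ s) ^ n.natAbs
    have hW : W ≠ ⊤ := tsum_pow_natAbs_ne_top (ENNReal.rpow_lt_one hρ hs0)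
    refine ⟨(K ^ s * W) ^ (1 / Q), ENNReal.rpow_ne_top_of_nonneg (by positivity)
      (ENNReal.mul_ne_top (ENNReal.rpow_ne_top_of_nonneg hs0.le hK) hW), fun f g hf hfg => ?_⟩
    rw [lorentzNorm_of_ne_top p hqt, lorentzNorm_of_ne_top p hqt,
      ← ENNReal.mul_rpow_of_nonneg _ _ (by positivity)]
    gcongr ?_ ^ _
    rw [mul_left_comm]
    gcongr
    have hm := fun f => (measurable_lorentzProfile p f).pow_const Q
    -- The pointwise estimate concerns the profile of `g` at `2t`. Dilation invariance allows this
    -- and later removes the factors `2ⁿ`, leaving the geometric sum `W`.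
    rw [← lintegral_comp_mul_div (hm g) two_pos]
    calc _ ≤ ∫⁻ t in Set.Ioi (0 : ℝ), ∑' n : ℤ, K ^ s * (ρ ^ s) ^ n.natAbs *
          (lorentzProfile p f ((2 : ℝ) ^ n * t) ^ Q / ENNReal.ofReal t) := by
          refine setLIntegral_mono' measurableSet_Ioi fun t ht => ?_
          have h1 : lorentzProfile p g (2 * t) ^ Q ≤ ∑' n : ℤ, K ^ s * (ρ ^ s) ^ n.natAbs *
              lorentzProfile p f ((2 : ℝ) ^ n * t) ^ Q := by
            calc _ = (lorentzProfile p g (2 * t) ^ p) ^ s := by rw [← ENNReal.rpow_mul, hps]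
              _ ≤ (K * ⨆ n : ℤ, ρ ^ n.natAbs * lorentzProfile p f ((2 : ℝ) ^ n * t) ^ p) ^ s := by
                  gcongr
                  exact h f g hf hfg t ht
              _ ≤ K ^ s * ∑' n : ℤ,
                  (ρ ^ n.natAbs * lorentzProfile p f ((2 : ℝ) ^ n * t) ^ p) ^ s := by
                  rw [ENNReal.mul_rpow_of_nonneg _ _ hs0.le]
                  gcongr
                  exact iSup_rpow_le_tsum _ hs0
              _ = _ := by
                  rw [← ENNReal.tsum_mul_left]
                  congr 1 with n
                  rw [ENNReal.mul_rpow_of_nonneg _ _ hs0.le, ← ENNReal.rpow_mul, hps,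
                    ← ENNReal.rpow_natCast, ← ENNReal.rpow_natCast, ← ENNReal.rpow_mul,
                    ← ENNReal.rpow_mul, mul_comm s, mul_assoc]
          calc _ ≤ (∑' n : ℤ, K ^ s * (ρ ^ s) ^ n.natAbs *
              lorentzProfile p f ((2 : ℝ) ^ n * t) ^ Q) / ENNReal.ofReal t := by gcongr
            _ = _ := by
              rw [div_eq_mul_inv, ← ENNReal.tsum_mul_right]
              congr 1 with n
              rw [div_eq_mul_inv, mul_assoc]
      _ = ∑' n : ℤ, K ^ s * (ρ ^ s) ^ n.natAbs * ∫⁻ t in Set.Ioi (0 : ℝ),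
          lorentzProfile p f t ^ Q / ENNReal.ofReal t := by
          have hmn : ∀ n : ℤ, Measurable fun t : ℝ =>
              lorentzProfile p f ((2 : ℝ) ^ n * t) ^ Q / ENNReal.ofReal t := fun n =>
            ((hm f).comp (measurable_const_mul _)).div ENNReal.measurable_ofReal
          rw [lintegral_tsum fun n => ((hmn n).const_mul _).aemeasurable]
          congr 1 with n
          rw [lintegral_const_mul _ (hmn n), lintegral_comp_mul_div (hm f) (by positivity)]
      _ = _ := by rw [ENNReal.tsum_mul_right, ENNReal.tsum_mul_left]

end Marcinkiewicz

/-! ### Lorentz functions lie in the domain of `Δ⁻¹`. -/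

/-- `L^{p,q}` embeds into `L^{p,∞}`. -/
lemma exists_lorentzProfile_bound {p : ℝ} (hp : 0 < p) {q : ENNReal} (hq : 1 ≤ q) {f : E3 → ℝ}
    (hf : lorentzNorm p q f < ⊤) :
    ∃ M : ENNReal, M ≠ ⊤ ∧ ∀ t, 0 < t → lorentzProfile p f t ^ p ≤ M := by
  rcases eq_or_ne q ⊤ with rfl | hqt
  · rw [lorentzNorm_top] at hf
    refine ⟨_, ENNReal.rpow_ne_top_of_nonneg hp.le hf.ne, fun t ht => ?_⟩
    gcongr
    exact le_iSup₂ (f := fun (t : ℝ) (_ : 0 < t) => lorentzProfile p f t) t ht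
  · rw [lorentzNorm_of_ne_top p hqt] at hf
    set Q := q.toReal with hQ
    have hQ0 : 0 < Q := ENNReal.toReal_pos (by positivity) hqt
    set I := ∫⁻ t in Set.Ioi (0 : ℝ), lorentzProfile p f t ^ Q / ENNReal.ofReal t with hI
    have hI' : I ≠ ⊤ := by
      rw [ENNReal.rpow_lt_top_iff_of_pos (by positivity)] at hf
      intro h
      rw [h, ENNReal.mul_top (ENNReal.ofReal_pos.2 hp).ne'] at hf
      exact lt_irrefl _ hf
    refine ⟨((2 * (2 ^ Q * I)) ^ (1 / Q)) ^ p, ?_, fun t ht => ?_⟩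
    · refine ENNReal.rpow_ne_top_of_nonneg hp.le (ENNReal.rpow_ne_top_of_nonneg (by positivity) ?_)
      exact ENNReal.mul_ne_top ENNReal.ofNat_ne_top (ENNReal.mul_ne_top
        (ENNReal.rpow_ne_top_of_nonneg hQ0.le ENNReal.ofNat_ne_top) hI')
    gcongr
    rw [one_div, ENNReal.le_rpow_inv_iff hQ0]
    have hτ0 : ENNReal.ofReal t ≠ 0 := (ENNReal.ofReal_pos.2 ht).ne'
    have hhalf : ENNReal.ofReal t = 2 * ENNReal.ofReal (t / 2) := by
      rw [← ENNReal.ofReal_ofNat 2, ← ENNReal.ofReal_mul zero_le_two, mul_div_cancel₀ _ two_ne_zero]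
    -- On this interval `t < 2s` and the distribution function at `t` is at most that at `s`, so the
    -- value at `t` is bounded by an average over the interval.
    have h1 : ∀ s ∈ Set.Ioc (t / 2) t, lorentzProfile p f t ^ Q / ENNReal.ofReal t
        ≤ 2 ^ Q * (lorentzProfile p f s ^ Q / ENNReal.ofReal s) := by
      intro s hs
      have h2 : lorentzProfile p f t ≤ 2 * lorentzProfile p f s := by
        unfold lorentzProfile
        rw [hhalf, mul_assoc]
        gcongr
        · exact hs.1.le
        · exact distrib_antitone f hs.2
      calc _ ≤ (2 * lorentzProfile p f s) ^ Q / ENNReal.ofReal s := by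
            gcongr
            exact hs.2
        _ = _ := by
            rw [ENNReal.mul_rpow_of_nonneg _ _ hQ0.le, mul_div_assoc]
    have hm := ((measurable_lorentzProfile p f).pow_const Q).div ENNReal.measurable_ofReal
    have h3 : lorentzProfile p f t ^ Q / ENNReal.ofReal t * ENNReal.ofReal (t / 2) ≤ 2 ^ Q * I := by
      calc _ = ∫⁻ _ in Set.Ioc (t / 2) t, lorentzProfile p f t ^ Q / ENNReal.ofReal t := by
            rw [setLIntegral_const, Real.volume_Ioc, sub_half]
        _ ≤ ∫⁻ s in Set.Ioc (t / 2) t, 2 ^ Q * (lorentzProfile p f s ^ Q / ENNReal.ofReal s) :=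
            setLIntegral_mono' measurableSet_Ioc h1
        _ ≤ ∫⁻ s in Set.Ioi 0, 2 ^ Q * (lorentzProfile p f s ^ Q / ENNReal.ofReal s) :=
            lintegral_mono_set fun s hs => (half_pos ht).trans hs.1
        _ = _ := lintegral_const_mul _ hm
    calc lorentzProfile p f t ^ Q
        = lorentzProfile p f t ^ Q / ENNReal.ofReal t * ENNReal.ofReal t :=
          (ENNReal.div_mul_cancel hτ0 ENNReal.ofReal_ne_top).symm
      _ = 2 * (lorentzProfile p f t ^ Q / ENNReal.ofReal t * ENNReal.ofReal (t / 2)) := by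
          rw [hhalf]; ring
      _ ≤ _ := by gcongr

lemma tsum_weight_ne_top {ρ M : ENNReal} (hρ : ρ < 1) (hM : M ≠ ⊤) {a : ℤ → ENNReal}
    (ha : ∀ n, a n ≤ M) : ∑' n : ℤ, ρ ^ n.natAbs * a n ≠ ⊤ := by
  refine ne_top_of_le_ne_top (ENNReal.mul_ne_top (tsum_pow_natAbs_ne_top hρ) hM) ?_
  rw [← ENNReal.tsum_mul_right]
  exact ENNReal.tsum_le_tsum fun n => by gcongr; exact ha n

/-- Functions in `L^{p,q}`, `p > 1`, have an inverse Laplacian. -/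
lemma hasInvLaplacian_of_lorentzNorm {p : ℝ} (hp : 1 < p) {q : ENNReal} (hq : 1 ≤ q) {f : E3 → ℝ}
    (hfm : Measurable f) (hf : lorentzNorm p q f < ⊤) : HasInvLaplacian f := by
  have hp0 : 0 < p := by linarith
  obtain ⟨M, hM, hM'⟩ := exists_lorentzProfile_bound hp0 hq hf
  set A : Set E3 := {x | 1 < |f x|}
  have hA : MeasurableSet A := measurableSet_lt measurable_const hfm.norm
  have hb : ∀ n : ℤ, lorentzProfile p f ((2 : ℝ) ^ n * 1) ^ p ≤ M := fun n => hM' _ (by positivity)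
  have h2top : ∀ x : ℝ, (2 : ENNReal) ^ x ≠ ⊤ := fun x =>
    ENNReal.rpow_ne_top_of_ne_zero two_ne_zero ENNReal.ofNat_ne_top
  -- The part of `f` above height 1 is in `L¹` and the rest in `L^{p+1}`; the latter is paired by
  -- Hölder with `(1 + |y|)⁻³`, which lies in `L^{q'}` because `3q' > 3`.
  have h0 : ∫⁻ x, A.indicator (fun y => ‖f y‖ₑ) x ≠ ⊤ := by
    have h := rpow_mul_lintegral_above_le hfm one_pos (s := 1) (p := p) one_pos hp0
    simp only [ENNReal.ofReal_one, ENNReal.one_rpow, one_mul, ENNReal.rpow_one, mul_one] at h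
    refine ne_top_of_le_ne_top (ENNReal.mul_ne_top ENNReal.ofNat_ne_top
      (tsum_weight_ne_top (two_rpow_neg_lt_one (by linarith)) hM fun n => ?_)) h
    simpa using hb n
  have h1 : ∫⁻ x, (Aᶜ.indicator (fun y => ‖f y‖ₑ) x) ^ (p + 1) ≠ ⊤ := by
    have h := rpow_mul_lintegral_below_le hfm one_pos (s := p + 1) (p := p) (by linarith) hp0
    rw [ENNReal.ofReal_one, ENNReal.one_rpow, ENNReal.one_rpow, one_mul, mul_one] at h
    exact ne_top_of_le_ne_top (ENNReal.mul_ne_top (h2top _)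
      (tsum_weight_ne_top (two_rpow_neg_lt_one (by linarith)) hM hb)) h
  set q' : ℝ := (p + 1) / p with hq'
  have hpq : (p + 1).HolderConjugate q' := by
    have := Real.HolderConjugate.conjExponent (p := p + 1) (by linarith)
    simpa [Real.conjExponent] using this
  set b : E3 → ENNReal := fun y => ENNReal.ofReal ((1 + ‖y‖) ^ (-3 : ℝ)) with hbdef
  have hbm : Measurable b := by fun_prop
  have h2 : ∫⁻ y, b y ^ q' ≠ ⊤ := by
    have hr : (Module.finrank ℝ E3 : ℝ) < 3 * q' := by
      have : 1 < q' := by rw [hq', one_lt_div hp0]; linarith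
      simp
      linarith
    have h := integrable_one_add_norm (E := E3) (μ := volume) hr
    have h3 := h.lintegral_lt_top
    refine ne_of_lt (lt_of_eq_of_lt (lintegral_congr fun y => ?_) h3)
    rw [hbdef, ENNReal.ofReal_rpow_of_nonneg (by positivity) hpq.symm.nonneg,
      ← Real.rpow_mul (by positivity), neg_mul]
  refine ⟨(hfm.div (by fun_prop)).aestronglyMeasurable, ?_⟩
  have hle : ∀ y, ‖f y / (1 + ‖y‖) ^ 3‖ₑ ≤ A.indicator (fun y => ‖f y‖ₑ) y
      + (Aᶜ.indicator (fun y => ‖f y‖ₑ) * b) y := by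
    intro y
    have hy : ‖f y / (1 + ‖y‖) ^ 3‖ₑ = ‖f y‖ₑ * b y := by
      rw [div_eq_mul_inv, enorm_mul, hbdef, ← ofReal_norm ((1 + ‖y‖) ^ 3)⁻¹, norm_inv,
        Real.norm_of_nonneg (by positivity)]
      dsimp only
      rw [Real.rpow_neg (by positivity)]
      norm_cast
    have hb1 : b y ≤ 1 := by
      rw [hbdef, ENNReal.ofReal_le_one]
      exact Real.rpow_le_one_of_one_le_of_nonpos (by linarith [norm_nonneg y]) (by norm_num)
    rw [hy, Pi.mul_apply]
    by_cases h : y ∈ A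
    · rw [Set.indicator_of_mem h, Set.indicator_of_notMem (by simpa using h), zero_mul, add_zero]
      exact mul_le_of_le_one_right' hb1
    · rw [Set.indicator_of_notMem h, Set.indicator_of_mem (by simpa using h), zero_add]
  refine lt_of_le_of_lt (lintegral_mono hle) ?_
  rw [lintegral_add_left (hfm.enorm.indicator hA)]
  refine ENNReal.add_lt_top.2 ⟨h0.lt_top, ?_⟩
  refine lt_of_le_of_lt (ENNReal.lintegral_mul_le_Lp_mul_Lq volume hpq
    (hfm.enorm.indicator hA.compl).aemeasurable hbm.aemeasurable) ?_
  exact ENNReal.mul_lt_top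
    (ENNReal.rpow_lt_top_of_nonneg (one_div_nonneg.2 hpq.nonneg) h1)
    (ENNReal.rpow_lt_top_of_nonneg (one_div_nonneg.2 hpq.symm.nonneg) h2)

end Axisym

end

theorem proposition2p9 :
    (∀ u : Axisym.E3 → ℝ, ContDiff ℝ (⊤ : ℕ∞) u → Axisym.IsAxisymmetric u →
      Axisym.HasInvLaplacian u →
        ContDiff ℝ (⊤ : ℕ∞) (Axisym.invLaplacian u) ∧
        (∀ x : Axisym.E3, ∑ i : Fin 3, Axisym.riesz i i u x = u x) ∧
        ∀ x : Axisym.E3, Axisym.r x ≠ 0 →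
          Axisym.drOverR (Axisym.invLaplacian u) x =
            x 1 ^ 2 / Axisym.r x ^ 2 * Axisym.riesz 0 0 u x
              + x 0 ^ 2 / Axisym.r x ^ 2 * Axisym.riesz 1 1 u x
              - 2 * (x 0 * x 1 / Axisym.r x ^ 2) * Axisym.riesz 0 1 u x) ∧
    (∀ (p : ℝ) (q : ENNReal), 1 < p → 1 ≤ q →
      ∃ C : ℝ, 0 < C ∧
        ∀ u : Axisym.E3 → ℝ, ContDiff ℝ (⊤ : ℕ∞) u → Axisym.IsAxisymmetric u →
          Axisym.lorentzNorm p q u < ⊤ →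
            Axisym.HasInvLaplacian u ∧
            Axisym.lorentzNorm p q (Axisym.drOverR (Axisym.invLaplacian u)) ≤
              ENNReal.ofReal C * Axisym.lorentzNorm p q u) := by
  refine ⟨fun u hu ha hi => ⟨Axisym.contDiff_invLaplacian hu hi, Axisym.sum_riesz hu hi,
    fun x hr => (Axisym.isAxisymmetric_invLaplacian ha).drOverR_eq
      (Axisym.contDiff_invLaplacian hu hi) hr⟩, fun p q hp hq => ?_⟩
  obtain ⟨C, hC, h⟩ := Axisym.exists_lorentzNorm_le hp hq
  -- Adding 1 makes the constant strictly positive even if `C = 0`.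
  refine ⟨C.toReal + 1, by positivity, fun u hu ha hn => ?_⟩
  have hm := hu.continuous.measurable
  have hi := Axisym.hasInvLaplacian_of_lorentzNorm hp hq hm hn
  refine ⟨hi, (h u _ hm ?_).trans ?_⟩
  · filter_upwards [Axisym.ae_apply_ne 0 0] with x hx
    exact Axisym.enorm_drOverR_invLaplacian_le hu ha hi hx
  · gcongr
    rw [← ENNReal.ofReal_toReal hC, ENNReal.toReal_ofReal ENNReal.toReal_nonneg]
    exact ENNReal.ofReal_le_ofReal (by linarith)
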